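/- Let $m\ge 0$ and $\mathcal H=L^2(\mathbb R^m)$, with inner product conjugate-linear in the first variable. For $q,p\in\mathbb R^m$ put $\vartheta_{qp}(x)=\pi^{-m/4}\,e^{ip\cdot(x-q/2)}\,e^{-\frac12\|x-q\|^2}$, and for a bounded operator $A$ on $\mathcal H$ put $\langle A\rangle(q,p)=\langle\vartheta_{qp},A\vartheta_{qp}\rangle$. Let $SK(A)\in\mathcal S'(\mathbb R^m\times\mathbb R^m)$ be the Schwartz kernel of $A$, that is, the tempered distribution with $\langle\varphi,A\psi\rangle=SK(A)(\overline\varphi\otimes\psi)$ for all $\varphi,\psi\in\mathcal S(\mathbb R^m)$. Let $\omega(x,y)=\pi^{-m}e^{-(\|x\|^2+\|y\|^2)}$ and $\tau(x,y)=(y+\frac x2,\,y-\frac x2)$ on $\mathbb R^m\times\mathbb R^m$; let $\mathcal F_I$ be the partial Fourier transform in the first variable, given on functions by $(\mathcal F_IF)(u,y)=(2\pi)^{-m/2}\int F(a,y)e^{-ia\cdot u}\,da$ and extended to tempered distributions by duality; and let $(\omega*T)(z)=(2\pi)^{-m}\,T(\omega(z-\cdot))$ for $T\in\mathcal S'(\mathbb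 R^{2m})$ and $z\in\mathbb R^{2m}$. Theorem. Let $A$ be a bounded operator on $\mathcal H$. The kernel $SK(A)$ exists, and for all $q,p\in\mathbb R^m$ $$\langle A\rangle(q,p)=(2\pi)^{3m/2}\,\{\omega*\mathcal F_I[SK(A)\circ\tau]\}(p,q).$$ If moreover $SK(A)$ is regular, i.e. given on $C_c^\infty$ by integration against a locally integrable function, again denoted $SK(A)$, then for all $q,p$ $$\langle A\rangle(q,p)=\frac1{\pi^m}\int_{\mathbb R^{3m}}SK(A)\Big(b+\frac t2,\,b-\frac t2\Big)\,e^{-[\|p-a\|^2+\|q-b\|^2]}\,e^{-it\cdot a}\,dt\,da\,db .$$ This integral need not converge absolutely. In general it is understood as the limit, as $\varepsilon\to0^+$, of the absolutely convergent integrals of the integrand multiplied by $\chi(\varepsilon t,\varepsilon b)$, for any $\chi\in C_c^\infty(\mathbb R^m\times\mathbb R^m)$ with $\chi(0)=1$. The formula also holds with the integral understood as $\int\!\int\big(\int\cdots\,da\big)\,dt\,db$ whenever the inner integral over $a$ is an integrable function of $(t,b)$, which is so in particular if $SK(A)\,f$ is integrable for every $f\in\mathcal S(\mathbb R^{2m})$;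 and it holds as a Lebesgue integral over $\mathbb R^{3m}$ whenever the integrand is integrable there. -/

import Mathlib

open MeasureTheory SchwartzMap
open scoped FourierTransform

set_option linter.unusedSectionVars false

namespace PartialFourier
section
variable {V : Type} [NormedAddCommGroup V] [InnerProductSpace ℝ V] [FiniteDimensional ℝ V]
  [MeasurableSpace V] [BorelSpace V]

theorem norm_iteratedFDeriv_slice_le {E : Type} [NormedAddCommGroup E] [NormedSpace ℂ E]
    (f : 𝓢(V × V, E)) (y a : V) (j : ℕ) :
    ‖iteratedFDeriv ℝ j (fun a => f (a, y)) a‖ ≤ ‖iteratedFDeriv ℝ j f (a, y)‖ := by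
  have h1 : (fun a => f (a, y)) =
      (fun z => f (z + (0, y))) ∘ (ContinuousLinearMap.inl ℝ V V) := by
    funext a; simp
  have hc : ContDiff ℝ (j : ℕ∞) (fun z => f (z + (0, y))) :=
    (f.smooth j).comp (contDiff_id.add contDiff_const)
  rw [h1, ContinuousLinearMap.iteratedFDeriv_comp_right _ hc _ le_rfl,
    iteratedFDeriv_comp_add_right]
  refine (ContinuousMultilinearMap.norm_compContinuousLinearMap_le _ _).trans ?_
  have : ∏ _i : Fin j, ‖ContinuousLinearMap.inl ℝ V V‖ ≤ 1 :=
    Finset.prod_le_one (fun _ _ => norm_nonneg (ContinuousLinearMap.inl ℝ V V))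
      (fun _ _ => ContinuousLinearMap.norm_inl_le_one ℝ V V)
  refine (mul_le_of_le_one_right (norm_nonneg _) this).trans (le_of_eq ?_)
  simp

theorem slice_contDiff {E : Type} [NormedAddCommGroup E] [NormedSpace ℂ E]
    (f : 𝓢(V × V, E)) (y : V) : ContDiff ℝ (⊤ : ℕ∞) (fun a => f (a, y)) :=
  (f.smooth ⊤).comp (contDiff_id.prodMk contDiff_const)

theorem slice_integrable {E : Type} [NormedAddCommGroup E] [NormedSpace ℂ E]
    (f : 𝓢(V × V, E)) (y : V) (k j : ℕ) :
    Integrable (fun a => ‖a‖ ^ k * ‖iteratedFDeriv ℝ j (fun a => f (a, y)) a‖) := by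
  apply integrable_of_le_of_pow_mul_le (C₁ := SchwartzMap.seminorm ℝ 0 j f)
    (C₂ := SchwartzMap.seminorm ℝ (k + (volume : Measure V).integrablePower) j f)
  · exact fun a => (norm_iteratedFDeriv_slice_le f y a j).trans
      (norm_iteratedFDeriv_le_seminorm ℝ f j _)
  · intro a
    refine le_trans ?_ (le_seminorm ℝ _ j f (a, y))
    gcongr
    · exact norm_fst_le (a, y)
    · exact norm_iteratedFDeriv_slice_le f y a j
  · exact ((slice_contDiff f y).continuous_iteratedFDeriv
      (mod_cast le_top)).aestronglyMeasurable

/-- The integrand of the Fourier integral in the first variable. -/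
noncomputable def integrand {E : Type} [NormedAddCommGroup E] [NormedSpace ℂ E]
    (f : V × V → E) (x : V × V) (a : V) : E :=
  ((Real.fourierChar (-inner ℝ a x.1) : Circle) : ℂ) • f (a, x.2)

/-- The Fourier integral in the first variable, normalized with `exp (-2πi ⟪a, u⟫)`. -/
noncomputable def pfun {E : Type} [NormedAddCommGroup E] [NormedSpace ℝ E] [NormedSpace ℂ E]
    (f : V × V → E) (x : V × V) : E := ∫ a, integrand f x a

theorem norm_integrand {E : Type} [NormedAddCommGroup E] [NormedSpace ℂ E]
    (f : V × V → E) (x : V × V) (a : V) : ‖integrand f x a‖ = ‖f (a, x.2)‖ := by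
  rw [integrand, norm_smul, Circle.norm_coe, one_mul]

theorem pfun_decay_aux {E : Type} [NormedAddCommGroup E] [NormedSpace ℂ E] (k : ℕ) :
    ∃ (s : Finset (ℕ × ℕ)) (C : ℝ), 0 ≤ C ∧ ∀ (f : 𝓢(V × V, E)) (x : V × V),
      ‖x‖ ^ k * ‖pfun f x‖ ≤ C * s.sup (schwartzSeminormFamily ℝ (V × V) E) f := by
  set N := (volume : Measure V).integrablePower with hN
  set I : ℝ := 2 ^ N * (∫ x : V, (1 + ‖x‖) ^ (-(N : ℝ))) with hI
  have hI0 : 0 ≤ I := by positivity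
  set s : Finset (ℕ × ℕ) := Finset.range (k + N + 1) ×ˢ Finset.range (k + 1) with hs
  refine ⟨s, 2 ^ k * (∑ p ∈ Finset.range (0 + 1) ×ˢ Finset.range (k + 1), I * 2) + I * 2,
    by positivity, fun f x => ?_⟩
  obtain ⟨u, y⟩ := x
  set S := s.sup (schwartzSeminormFamily ℝ (V × V) E) f with hS
  have hle : ∀ i j, i < k + N + 1 → j < k + 1 → SchwartzMap.seminorm ℝ i j f ≤ S := by
    intro i j hi hj
    have : (i, j) ∈ s := by simp [hs, hi, hj]
    exact Seminorm.le_def.1 (Finset.le_sup (f := schwartzSeminormFamily ℝ (V × V) E) this) f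
  have hu : ‖u‖ ^ k * ‖pfun f (u, y)‖ ≤
      2 ^ k * (∑ p ∈ Finset.range (0 + 1) ×ˢ Finset.range (k + 1), I * 2) * S := by
    have := Real.pow_mul_norm_iteratedFDeriv_fourier_le (K := 0) (N := ⊤) (k := 0) (n := k)
      (slice_contDiff f y)
      (fun k n _ _ => slice_integrable f y k n) (by simp) (mod_cast le_top) u
    rw [norm_iteratedFDeriv_zero, Real.fourier_eq] at this
    refine this.trans ?_
    have e : (2 * Real.pi) ^ 0 * (2 * ((0 : ℕ) : ℝ) + 2) ^ k = 2 ^ k := by simp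
    rw [e, mul_assoc, Finset.sum_mul]
    gcongr with p hp
    have hp' : p.1 = 0 ∧ p.2 < k + 1 := by
      have h := Finset.mem_product.1 hp
      have h1 := Finset.mem_range.1 h.1
      exact ⟨by omega, Finset.mem_range.1 h.2⟩
    obtain ⟨hp1, hp2⟩ := hp'
    rw [hp1]
    refine (integral_pow_mul_le_of_le_of_pow_mul_le (C₁ := S) (C₂ := S) ?_ ?_).trans
      (le_of_eq (by rw [hI]; ring))
    · exact fun a => (norm_iteratedFDeriv_slice_le f y a _).trans
        ((norm_iteratedFDeriv_le_seminorm ℝ f _ _).trans (hle _ _ (by omega) hp2))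
    · intro a
      refine le_trans ?_ ((le_seminorm ℝ (0 + N) p.2 f (a, y)).trans (hle _ _ (by omega) hp2))
      gcongr
      · exact norm_fst_le (a, y)
      · exact norm_iteratedFDeriv_slice_le f y a _
  have hy : ‖y‖ ^ k * ‖pfun f (u, y)‖ ≤ I * 2 * S := by
    have h1 : ‖pfun f (u, y)‖ ≤ ∫ a, ‖f (a, y)‖ := by
      unfold pfun
      refine (norm_integral_le_integral_norm _).trans (le_of_eq ?_)
      simp only [norm_integrand]
    calc ‖y‖ ^ k * ‖pfun f (u, y)‖ ≤ ‖y‖ ^ k * ∫ a, ‖f (a, y)‖ := by gcongr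
      _ = ∫ a : V, ‖a‖ ^ 0 * ‖‖y‖ ^ k * ‖f (a, y)‖‖ := by
        rw [← integral_const_mul]; simp
      _ ≤ _ := by
        refine (integral_pow_mul_le_of_le_of_pow_mul_le (C₁ := S) (C₂ := S) ?_ ?_).trans
          (le_of_eq (by rw [hI]; ring))
        · intro a
          rw [norm_mul, norm_norm, norm_pow, norm_norm]
          refine le_trans ?_ ((norm_pow_mul_le_seminorm ℝ f k (a, y)).trans
            (hle _ _ (by omega) (by omega)))
          gcongr
          exact norm_snd_le (a, y)
        · intro a
          rw [norm_mul, norm_norm, norm_pow, norm_norm, zero_add, ← mul_assoc]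
          refine le_trans ?_ ((norm_pow_mul_le_seminorm ℝ f (N + k) (a, y)).trans
            (hle _ _ (by omega) (by omega)))
          rw [pow_add]
          gcongr
          · exact norm_fst_le (a, y)
          · exact norm_snd_le (a, y)
  have hmax : ‖(u, y)‖ ^ k ≤ ‖u‖ ^ k + ‖y‖ ^ k := by
    rw [Prod.norm_mk]
    rcases le_total ‖u‖ ‖y‖ with h | h
    · rw [max_eq_right h]; linarith [pow_nonneg (norm_nonneg u) k]
    · rw [max_eq_left h]; linarith [pow_nonneg (norm_nonneg y) k]
  calc ‖(u, y)‖ ^ k * ‖pfun f (u, y)‖ ≤ (‖u‖ ^ k + ‖y‖ ^ k) * ‖pfun f (u, y)‖ := by gcongr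
    _ ≤ _ := by rw [add_mul, add_mul]; exact add_le_add hu hy

theorem pfun_decay {E : Type} [NormedAddCommGroup E] [hR : NormedSpace ℝ E] [NormedSpace ℂ E]
    [IsScalarTower ℝ ℂ E] (k : ℕ) :
    ∃ (s : Finset (ℕ × ℕ)) (C : ℝ), 0 ≤ C ∧ ∀ (f : 𝓢(V × V, E)) (x : V × V),
      ‖x‖ ^ k * ‖pfun f x‖ ≤ C * s.sup (schwartzSeminormFamily ℝ (V × V) E) f := by
  have h : hR = NormedSpace.complexToReal := by
    ext r x
    exact algebraMap_smul (R := ℝ) (A := ℂ) r x |>.symm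
  subst h
  exact pfun_decay_aux k

/-- The inner product of the first components, as a bilinear form. -/
noncomputable def fstInner : (V × V) →L[ℝ] (V × V) →L[ℝ] ℝ :=
  (innerSL ℝ (E := V)).bilinearComp (ContinuousLinearMap.fst ℝ V V)
    (ContinuousLinearMap.fst ℝ V V)

/-- The operator on Schwartz functions that describes the derivative of `pfun`. -/
noncomputable def dop (E : Type) [NormedAddCommGroup E] [NormedSpace ℝ E] [NormedSpace ℂ E]
    [IsScalarTower ℝ ℂ E] :
    𝓢(V × V, E) →L[ℝ] 𝓢(V × V, (V × V) →L[ℝ] E) :=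
  (SchwartzMap.postcompCLM ((ContinuousLinearMap.compL ℝ (V × V) (V × V) E).flip
      ((ContinuousLinearMap.inr ℝ V V).comp (ContinuousLinearMap.snd ℝ V V)))) ∘L
    (SchwartzMap.fderivCLM ℝ (V × V) E) +
  (SchwartzMap.smulRightCLM ℝ E (fstInner (V := V))) ∘L
    ((-(2 * Real.pi * Complex.I) : ℂ) • ContinuousLinearMap.id ℝ 𝓢(V × V, E))

theorem dop_apply {E : Type} [NormedAddCommGroup E] [NormedSpace ℝ E] [NormedSpace ℂ E]
    [IsScalarTower ℝ ℂ E] (f : 𝓢(V × V, E))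
    (x v : V × V) :
    dop E f x v = fderiv ℝ f x (0, v.2) +
      (inner ℝ x.1 v.1 : ℝ) • ((-(2 * Real.pi * Complex.I) : ℂ) • f x) := by
  simp [dop, fstInner]

theorem hasFDerivAt_integrand {E : Type} [NormedAddCommGroup E] [NormedSpace ℝ E]
    [NormedSpace ℂ E] [IsScalarTower ℝ ℂ E]
    (f : 𝓢(V × V, E)) (a : V) (z : V × V) :
    HasFDerivAt (fun z : V × V => integrand f z a) (integrand (dop E f) z a) z := by
  have h1 : HasFDerivAt (fun z : V × V => ((Real.fourierChar (-inner ℝ a z.1) : Circle) : ℂ))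
      (((-2 * Real.pi * Complex.I * ((Real.fourierChar (-inner ℝ a z.1) : Circle) : ℂ)) •
        (Complex.ofRealCLM ∘L (innerSL ℝ a))) ∘L (ContinuousLinearMap.fst ℝ V V)) z :=
    (Real.hasFDerivAt_fourierChar_neg_bilinear_right (innerSL ℝ (E := V)) a z.1).comp z
        (hasFDerivAt_fst (𝕜 := ℝ) (p := z))
  have h2 : HasFDerivAt (fun z : V × V => f (a, z.2))
      ((fderiv ℝ f (a, z.2)).comp
        ((0 : V × V →L[ℝ] V).prod (ContinuousLinearMap.snd ℝ V V))) z :=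
    HasFDerivAt.comp z (f.differentiableAt (x := (a, z.2))).hasFDerivAt
      ((hasFDerivAt_const a z).prodMk (hasFDerivAt_snd (𝕜 := ℝ) (p := z)))
  have h3 := h1.smul h2
  refine h3.congr_fderiv ?_
  refine ContinuousLinearMap.ext fun v => ?_
  have e : (integrand (dop E f) z a) v =
      ((Real.fourierChar (-inner ℝ a z.1) : Circle) : ℂ) • (dop E f (a, z.2) v) := rfl
  rw [e, dop_apply, smul_add]
  simp only [add_apply, smul_apply,
    ContinuousLinearMap.comp_apply, ContinuousLinearMap.prod_apply, zero_apply,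
    ContinuousLinearMap.smulRight_apply, ContinuousLinearMap.coe_snd',
    ContinuousLinearMap.coe_fst', Complex.ofRealCLM_apply, smul_eq_mul]
  congr 1
  rw [← algebraMap_smul ℂ (inner ℝ a v.1 : ℝ), smul_smul, smul_smul]
  congr 1
  have h3 : ∀ (e : ℂ) (r : ℝ), (-2 * Real.pi * Complex.I * e) * r =
    e * r * -(2 * Real.pi * Complex.I) := by intros; ring
  exact h3 _ _

theorem slice_bound {E : Type} [NormedAddCommGroup E] [NormedSpace ℝ E] (g : 𝓢(V × V, E)) :
    ∃ C : ℝ, ∀ y a : V, ‖g (a, y)‖ ≤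
      C * (1 + ‖a‖) ^ (-((volume : Measure V).integrablePower : ℝ)) := by
  refine ⟨2 ^ (volume : Measure V).integrablePower *
      (SchwartzMap.seminorm ℝ 0 0 g +
        SchwartzMap.seminorm ℝ (volume : Measure V).integrablePower 0 g), fun y a => ?_⟩
  have h := pow_mul_le_of_le_of_pow_mul_le (k := 0) (l := (volume : Measure V).integrablePower)
    (norm_nonneg a)
    (norm_nonneg (g (a, y))) (norm_le_seminorm ℝ g (a, y))
    (C₂ := SchwartzMap.seminorm ℝ (volume : Measure V).integrablePower 0 g) (by
      refine le_trans ?_ (norm_pow_mul_le_seminorm ℝ g _ (a, y))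
      rw [zero_add]
      gcongr
      exact norm_fst_le (a, y))
  simpa using h

theorem continuous_integrand {E : Type} [NormedAddCommGroup E] [NormedSpace ℝ E]
    [NormedSpace ℂ E] (g : 𝓢(V × V, E)) (z : V × V) : Continuous (integrand g z) := by
  have := g.continuous
  have h2 : Continuous fun a : V => ((Real.fourierChar (-inner ℝ a z.1) : Circle) : ℂ) :=
    Continuous.comp (g := ((↑) : Circle → ℂ)) (by fun_prop) (Real.continuous_fourierChar.comp (by fun_prop))
  exact h2.smul (this.comp (by fun_prop))

theorem aesm_integrand {E : Type} [NormedAddCommGroup E] [NormedSpace ℝ E]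
    [NormedSpace ℂ E] (g : 𝓢(V × V, E)) (z : V × V) :
    AEStronglyMeasurable (integrand g z) volume :=
  (continuous_integrand g z).aestronglyMeasurable

theorem integrand_bound {E : Type} [NormedAddCommGroup E] [NormedSpace ℝ E]
    [NormedSpace ℂ E] (g : 𝓢(V × V, E)) :
    ∃ C : ℝ, ∀ (a : V) (z : V × V), ‖integrand g z a‖ ≤
      C * (1 + ‖a‖) ^ (-((volume : Measure V).integrablePower : ℝ)) := by
  obtain ⟨C, hC⟩ := slice_bound g
  exact ⟨C, fun a z => by rw [norm_integrand]; exact hC z.2 a⟩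

theorem integrable_integrand {E : Type} [NormedAddCommGroup E] [NormedSpace ℝ E]
    [NormedSpace ℂ E] (g : 𝓢(V × V, E)) (z : V × V) : Integrable (integrand g z) := by
  obtain ⟨C, hC⟩ := integrand_bound g
  exact ((Measure.integrable_pow_neg_integrablePower _).const_mul C).mono'
    (aesm_integrand g z) (Filter.Eventually.of_forall fun a => hC a z)

theorem hasFDerivAt_pfun {E : Type} [NormedAddCommGroup E] [NormedSpace ℝ E]
    [NormedSpace ℂ E] [IsScalarTower ℝ ℂ E]
    (f : 𝓢(V × V, E)) (x : V × V) : HasFDerivAt (pfun f) (pfun (dop E f) x) x := by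
  obtain ⟨C, hC⟩ := integrand_bound (dop E f)
  exact hasFDerivAt_integral_of_dominated_of_fderiv_le (𝕜 := ℝ) (s := Set.univ)
    (F := integrand f) (F' := integrand (dop E f))
    Filter.univ_mem (Filter.Eventually.of_forall fun z => aesm_integrand f z)
    (integrable_integrand f x) (aesm_integrand (dop E f) x)
    (Filter.Eventually.of_forall fun a z _ => hC a z)
    ((Measure.integrable_pow_neg_integrablePower _).const_mul C)
    (Filter.Eventually.of_forall fun a z _ => hasFDerivAt_integrand f a z)

theorem pfun_contDiff_nat (n : ℕ) : ∀ {E : Type} [NormedAddCommGroup E] [NormedSpace ℝ E] [NormedSpace ℂ E]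
    [IsScalarTower ℝ ℂ E]
    (f : 𝓢(V × V, E)), ContDiff ℝ n (pfun f) := by
  induction n with
  | zero =>
    intro E _ _ _ _ f
    exact contDiff_zero.2
      (continuous_iff_continuousAt.2 fun x => (hasFDerivAt_pfun f x).continuousAt)
  | succ n ih =>
    intro E _ _ _ _ f
    push_cast
    rw [contDiff_succ_iff_fderiv]
    refine ⟨fun x => (hasFDerivAt_pfun f x).differentiableAt, by simp, ?_⟩
    have : fderiv ℝ (pfun f) = pfun (dop E f) := funext fun x => (hasFDerivAt_pfun f x).fderiv
    rw [this]
    exact ih _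

theorem continuous_sup_seminorm {X E : Type} [NormedAddCommGroup X] [NormedSpace ℝ X]
    [NormedAddCommGroup E] [NormedSpace ℝ E] (s : Finset (ℕ × ℕ)) :
    Continuous (s.sup (schwartzSeminormFamily ℝ X E) : Seminorm ℝ 𝓢(X, E)) := by
  induction s using Finset.induction_on with
  | empty => exact continuous_const (y := (0 : ℝ))
  | insert i s _ hs =>
    rw [Finset.sup_insert, Seminorm.coe_sup]
    exact ((schwartz_withSeminorms ℝ X E).continuous_seminorm i).sup hs

theorem pfun_bound (n : ℕ) : ∀ {E : Type} [NormedAddCommGroup E] [NormedSpace ℝ E] [NormedSpace ℂ E]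
    [IsScalarTower ℝ ℂ E] (k : ℕ),
    ∃ (s : Finset (ℕ × ℕ)) (C : ℝ), 0 ≤ C ∧ ∀ (f : 𝓢(V × V, E)) (x : V × V),
      ‖x‖ ^ k * ‖iteratedFDeriv ℝ n (pfun f) x‖ ≤
        C * s.sup (schwartzSeminormFamily ℝ (V × V) E) f := by
  induction n with
  | zero =>
    intro E _ _ _ _ k
    simpa using pfun_decay (V := V) (E := E) k
  | succ n ih =>
    intro E _ _ _ _ k
    obtain ⟨s, C, hC, h⟩ := ih (E := (V × V) →L[ℝ] E) k
    have hcont : Continuous ((s.sup (schwartzSeminormFamily ℝ (V × V) ((V × V) →L[ℝ] E))).comp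
        (dop (V := V) E).toLinearMap) := by
      exact (continuous_sup_seminorm s).comp (dop (V := V) E).continuous
    obtain ⟨t, D, -, hD⟩ := Seminorm.bound_of_continuous
      (schwartz_withSeminorms ℝ (V × V) E) _ hcont
    refine ⟨t, C * D, by positivity, fun f x => ?_⟩
    have e : fderiv ℝ (pfun f) = pfun (dop E f) := funext fun x => (hasFDerivAt_pfun f x).fderiv
    rw [← norm_iteratedFDeriv_fderiv, e, mul_assoc]
    refine (h _ x).trans ?_
    gcongr
    exact hD f


theorem sup_seminorm_complex {X : Type} [NormedAddCommGroup X] [NormedSpace ℝ X]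
    (s : Finset (ℕ × ℕ)) (f : 𝓢(X, ℂ)) :
    s.sup (schwartzSeminormFamily ℂ X ℂ) f = s.sup (schwartzSeminormFamily ℝ X ℂ) f := by
  induction s using Finset.induction_on with
  | empty => rfl
  | insert i s _ hs =>
    rw [Finset.sup_insert, Finset.sup_insert, Seminorm.coe_sup, Seminorm.coe_sup, Pi.sup_apply,
      Pi.sup_apply, hs]
    rfl

theorem exists_pfunCLM : ∃ L : 𝓢(V × V, ℂ) →L[ℂ] 𝓢(V × V, ℂ), ∀ f x, L f x = pfun f x := by
  refine ⟨SchwartzMap.mkCLM (fun f => pfun f) ?_ ?_ ?_ ?_, fun f x => rfl⟩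
  · intro f g x
    have := integral_add (integrable_integrand f x) (integrable_integrand g x)
    rw [pfun, pfun, pfun, ← this]
    congr 1; funext a
    simp [integrand, mul_add]
  · intro c f x
    rw [pfun, pfun, RingHom.id_apply, ← integral_smul]
    congr 1; funext a
    simp [integrand]; ring
  · exact fun f => contDiff_infty.2 fun n => pfun_contDiff_nat n f
  · rintro ⟨k, n⟩
    obtain ⟨s, C, hC, h⟩ := pfun_bound (V := V) n (E := ℂ) k
    refine ⟨s, C, hC, fun f x => ?_⟩
    rw [sup_seminorm_complex]
    exact h f x

end
end PartialFourier

namespace PhaseSpace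

/-- Configuration space `ℝ^m` with its Euclidean structure and Lebesgue measure. -/
abbrev Pos (m : ℕ) : Type := EuclideanSpace ℝ (Fin m)

/-- The Hilbert space `L²(ℝ^m)`. -/
abbrev L2 (m : ℕ) : Type := Lp ℂ 2 (volume : Measure (Pos m))

variable {m : ℕ}

section Gaussian

theorem norm_iteratedFDeriv_exp (n : ℕ) (t : ℝ) : ‖iteratedFDeriv ℝ n Real.exp t‖ = Real.exp t := by
  rw [norm_iteratedFDeriv_eq_norm_iteratedDeriv, iteratedDeriv_eq_iterate, Real.iter_deriv_exp]
  simp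

theorem phase_temperate :
    (fun z : Pos m × Pos m => -(‖z.1‖ ^ 2 + ‖z.2‖ ^ 2)).HasTemperateGrowth := by
  have h1 : (fun z : Pos m × Pos m => ‖z.1‖ ^ 2).HasTemperateGrowth :=
    (Function.hasTemperateGrowth_norm_sq (H := Pos m)).comp
      (ContinuousLinearMap.fst ℝ (Pos m) (Pos m)).hasTemperateGrowth
  have h2 : (fun z : Pos m × Pos m => ‖z.2‖ ^ 2).HasTemperateGrowth :=
    (Function.hasTemperateGrowth_norm_sq (H := Pos m)).comp
      (ContinuousLinearMap.snd ℝ (Pos m) (Pos m)).hasTemperateGrowth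
  exact (h1.add h2).neg

theorem exists_poly_mul_exp_bound (N : ℕ) :
    ∃ C : ℝ, ∀ r : ℝ, 0 ≤ r → (1 + r) ^ N * Real.exp (-r ^ 2) ≤ C := by
  refine ⟨N.factorial * Real.exp 2, fun r hr => ?_⟩
  have h1 : (1 + r) ^ N ≤ N.factorial * Real.exp (1 + r) := by
    have := Real.pow_div_factorial_le_exp (1 + r) (by positivity) N
    rw [div_le_iff₀ (by positivity)] at this
    linarith
  calc (1 + r) ^ N * Real.exp (-r ^ 2)
      ≤ (N.factorial * Real.exp (1 + r)) * Real.exp (-r ^ 2) := by gcongr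
    _ = N.factorial * Real.exp (1 + r - r ^ 2) := by
      rw [mul_assoc, ← Real.exp_add]; ring_nf
    _ ≤ _ := by
      gcongr
      nlinarith [sq_nonneg (r - 1)]

theorem gaussian_decay (k n : ℕ) : ∃ C : ℝ, ∀ z : Pos m × Pos m, ‖z‖ ^ k *
    ‖iteratedFDeriv ℝ n (fun z : Pos m × Pos m => Real.exp (-(‖z.1‖ ^ 2 + ‖z.2‖ ^ 2))) z‖ ≤ C := by
  obtain ⟨l, C, hC, h⟩ := (phase_temperate (m := m)).norm_iteratedFDeriv_le_uniform n
  obtain ⟨B, hB⟩ := exists_poly_mul_exp_bound (k + l * n)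
  refine ⟨n.factorial * (C + 1) ^ n * B, fun z => ?_⟩
  set P : Pos m × Pos m → ℝ := fun z => -(‖z.1‖ ^ 2 + ‖z.2‖ ^ 2) with hP
  have hz : P z ≤ -‖z‖ ^ 2 := by
    rw [hP, Prod.norm_def]
    rcases le_total ‖z.1‖ ‖z.2‖ with h | h
    · rw [max_eq_right h]; simp only; nlinarith [sq_nonneg ‖z.1‖]
    · rw [max_eq_left h]; simp only; nlinarith [sq_nonneg ‖z.2‖]
  have key := norm_iteratedFDeriv_comp_le (𝕜 := ℝ) (g := Real.exp) (f := P) (n := n)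
    (N := (⊤ : ℕ∞)) Real.contDiff_exp phase_temperate.1 (mod_cast le_top) z
    (C := Real.exp (P z)) (D := (C + 1) * (1 + ‖z‖) ^ l)
    (fun i _ => (norm_iteratedFDeriv_exp i _).le) (fun i hi hin => by
      refine (h i hin z).trans ?_
      rw [mul_pow]
      gcongr
      · exact le_trans (by linarith) (le_self_pow₀ (by linarith) (by omega))
      · exact le_self_pow₀ (one_le_pow₀ (by linarith [norm_nonneg z])) (by omega))
  calc ‖z‖ ^ k * ‖iteratedFDeriv ℝ n (Real.exp ∘ P) z‖
      ≤ (1 + ‖z‖) ^ k * (n.factorial * Real.exp (-‖z‖ ^ 2) * ((C + 1) * (1 + ‖z‖) ^ l) ^ n) := by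
        gcongr
        · linarith
        · refine key.trans ?_
          gcongr
    _ = n.factorial * (C + 1) ^ n * ((1 + ‖z‖) ^ (k + l * n) * Real.exp (-‖z‖ ^ 2)) := by
        rw [mul_pow, ← pow_mul, pow_add]; ring
    _ ≤ _ := by
        gcongr
        exact hB _ (norm_nonneg z)

/-- The unnormalized Gaussian `exp (-(‖x‖² + ‖y‖²))` as a Schwartz function. -/
noncomputable def realGaussian (m : ℕ) : 𝓢(Pos m × Pos m, ℝ) where
  toFun z := Real.exp (-(‖z.1‖ ^ 2 + ‖z.2‖ ^ 2))
  smooth' := Real.contDiff_exp.comp phase_temperate.1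
  decay' k n := gaussian_decay k n

end Gaussian

/-- The normalized Gaussian `ω(x, y) = π^{-m} exp (-(‖x‖² + ‖y‖²))` on `ℝ^m × ℝ^m`. -/
noncomputable def omega (m : ℕ) : 𝓢(Pos m × Pos m, ℂ) :=
  ((Real.pi ^ m)⁻¹ : ℂ) • SchwartzMap.postcompCLM Complex.ofRealCLM (realGaussian m)

theorem omega_apply (x y : Pos m) :
    omega m (x, y) = ((1 / Real.pi ^ m * Real.exp (-(‖x‖ ^ 2 + ‖y‖ ^ 2)) : ℝ) : ℂ) := by
  have h : omega m (x, y) = ((Real.pi ^ m)⁻¹ : ℂ) *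
      ((Real.exp (-(‖x‖ ^ 2 + ‖y‖ ^ 2)) : ℝ) : ℂ) := rfl
  rw [h]
  push_cast
  rw [one_div]

/-- The fundamental state centered in `(q, p)`, as a function. -/
noncomputable def theta (q p : Pos m) (x : Pos m) : ℂ :=
  ((1 / Real.pi ^ ((m : ℝ) / 4) : ℝ) : ℂ) *
    Complex.exp (Complex.I * ((inner ℝ p (x - (1 / 2 : ℝ) • q) : ℝ) : ℂ)) *
    ((Real.exp (-(1 / 2) * ‖x - q‖ ^ 2) : ℝ) : ℂ)

theorem continuous_theta (q p : Pos m) : Continuous (theta q p) := by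
  unfold theta
  fun_prop

theorem memLp_theta (q p : Pos m) : MemLp (theta q p) 2 (volume : Measure (Pos m)) := by
  rw [memLp_two_iff_integrable_sq_norm (continuous_theta q p).aestronglyMeasurable]
  have h0 := (GaussianFourier.integrable_cexp_neg_mul_sq_norm_add (V := Pos m) (b := 1)
    (by simp) 0 0).norm
  have h1 := (h0.comp_sub_right q).const_mul ((1 / Real.pi ^ ((m : ℝ) / 4)) ^ 2)
  refine h1.congr (Filter.Eventually.of_forall fun x => ?_)
  have e1 : ‖Complex.exp (Complex.I * ((inner ℝ p (x - (1 / 2 : ℝ) • q) : ℝ) : ℂ))‖ = 1 := by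
    rw [mul_comm]; exact Complex.norm_exp_ofReal_mul_I _
  have e2 : ‖Complex.exp (-1 * (‖x - q‖ : ℂ) ^ 2 + 0 * ((inner ℝ (0 : Pos m) (x - q) : ℝ) : ℂ))‖ =
      Real.exp (-(1 / 2) * ‖x - q‖ ^ 2) ^ 2 := by
    rw [Complex.norm_exp, ← Real.exp_nat_mul]
    congr 1
    have : (-1 * (‖x - q‖ : ℂ) ^ 2 + 0 * ((inner ℝ (0 : Pos m) (x - q) : ℝ) : ℂ)) =
      ((-‖x - q‖ ^ 2 : ℝ) : ℂ) := by push_cast; ring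
    rw [this, Complex.ofReal_re]
    push_cast; ring
  simp only [e2]
  rw [theta, norm_mul, norm_mul, e1, Complex.norm_real, Complex.norm_real, mul_one, mul_pow,
    Real.norm_of_nonneg (by positivity), Real.norm_of_nonneg (by positivity)]

/-- The fundamental state centered in `(q, p)`, as a vector of `L²(ℝ^m)`. -/
noncomputable def fundamentalState (q p : Pos m) : L2 m := (memLp_theta q p).toLp (theta q p)

/-- The symbol `⟨A⟩(q, p) = ⟨ϑ_{qp}, A ϑ_{qp}⟩` (inner product conjugate-linear on the left). -/
noncomputable def expectedValue (A : L2 m →L[ℂ] L2 m) (q p : Pos m) : ℂ :=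
  inner ℂ (fundamentalState q p) (A (fundamentalState q p))

/-- The pointwise complex conjugate of a Schwartz function. -/
noncomputable def conjSchwartz (φ : 𝓢(Pos m, ℂ)) : 𝓢(Pos m, ℂ) :=
  SchwartzMap.postcompCLM (𝕜 := ℝ) (Complex.conjCLE : ℂ →L[ℝ] ℂ) φ

theorem conjSchwartz_apply (φ : 𝓢(Pos m, ℂ)) (x : Pos m) :
    conjSchwartz φ x = (starRingEnd ℂ) (φ x) := rfl

theorem norm_iteratedFDeriv_comp_clm_le (f : 𝓢(Pos m, ℂ))
    (L : Pos m × Pos m →L[ℝ] Pos m) (hL : ‖L‖ ≤ 1) (n : ℕ) (z : Pos m × Pos m) :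
    ‖iteratedFDeriv ℝ n (fun z => f (L z)) z‖ ≤ ‖iteratedFDeriv ℝ n f (L z)‖ := by
  have h : (fun z => f (L z)) = f ∘ L := rfl
  rw [h, ContinuousLinearMap.iteratedFDeriv_comp_right _ (f.smooth n) _ le_rfl]
  refine (ContinuousMultilinearMap.norm_compContinuousLinearMap_le _ _).trans ?_
  exact mul_le_of_le_one_right (norm_nonneg _)
    (Finset.prod_le_one (fun _ _ => norm_nonneg L) (fun _ _ => hL))

theorem tensor_decay (φ ψ : 𝓢(Pos m, ℂ)) (k n : ℕ) : ∃ C : ℝ, ∀ z : Pos m × Pos m,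
    ‖z‖ ^ k * ‖iteratedFDeriv ℝ n (fun z : Pos m × Pos m => φ z.1 * ψ z.2) z‖ ≤ C := by
  set S : ℕ → ℕ → 𝓢(Pos m, ℂ) → ℝ := fun i j f => SchwartzMap.seminorm ℝ i j f with hS
  refine ⟨∑ i ∈ Finset.range (n + 1), (n.choose i : ℝ) *
    (S k i φ * S 0 (n - i) ψ + S 0 i φ * S k (n - i) ψ), fun z => ?_⟩
  have hφ : ContDiff ℝ n (fun z : Pos m × Pos m => φ z.1) :=
    (φ.smooth n).comp contDiff_fst
  have hψ : ContDiff ℝ n (fun z : Pos m × Pos m => ψ z.2) :=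
    (ψ.smooth n).comp contDiff_snd
  have h := norm_iteratedFDeriv_mul_le (A := ℂ) hφ hψ z (n := n) le_rfl
  have hk : ‖z‖ ^ k ≤ ‖z.1‖ ^ k + ‖z.2‖ ^ k := by
    rw [Prod.norm_def]
    rcases le_total ‖z.1‖ ‖z.2‖ with h | h
    · rw [max_eq_right h]; linarith [pow_nonneg (norm_nonneg z.1) k]
    · rw [max_eq_left h]; linarith [pow_nonneg (norm_nonneg z.2) k]
  refine (mul_le_mul_of_nonneg_left h (by positivity)).trans ?_
  rw [Finset.mul_sum]
  refine Finset.sum_le_sum fun i _ => ?_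
  have a1 := norm_iteratedFDeriv_comp_clm_le φ (ContinuousLinearMap.fst ℝ (Pos m) (Pos m))
    (ContinuousLinearMap.norm_fst_le ℝ _ _) i z
  have a2 := norm_iteratedFDeriv_comp_clm_le ψ (ContinuousLinearMap.snd ℝ (Pos m) (Pos m))
    (ContinuousLinearMap.norm_snd_le ℝ _ _) (n - i) z
  simp only [ContinuousLinearMap.coe_fst', ContinuousLinearMap.coe_snd'] at a1 a2
  have b1 := le_seminorm ℝ k i φ z.1
  have b2 := le_seminorm ℝ k (n - i) ψ z.2
  have c1 := norm_iteratedFDeriv_le_seminorm ℝ φ i z.1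
  have c2 := norm_iteratedFDeriv_le_seminorm ℝ ψ (n - i) z.2
  calc ‖z‖ ^ k * ((n.choose i : ℝ) * ‖iteratedFDeriv ℝ i (fun z : Pos m × Pos m => φ z.1) z‖ *
        ‖iteratedFDeriv ℝ (n - i) (fun z : Pos m × Pos m => ψ z.2) z‖)
      ≤ (‖z.1‖ ^ k + ‖z.2‖ ^ k) * ((n.choose i : ℝ) * ‖iteratedFDeriv ℝ i φ z.1‖ *
        ‖iteratedFDeriv ℝ (n - i) ψ z.2‖) := by gcongr
    _ = (n.choose i : ℝ) * ((‖z.1‖ ^ k * ‖iteratedFDeriv ℝ i φ z.1‖) *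
          ‖iteratedFDeriv ℝ (n - i) ψ z.2‖ + ‖iteratedFDeriv ℝ i φ z.1‖ *
          (‖z.2‖ ^ k * ‖iteratedFDeriv ℝ (n - i) ψ z.2‖)) := by ring
    _ ≤ _ := by
      gcongr

/-- The tensor product `(φ ⊗ ψ)(x, y) = φ(x) ψ(y)` of two Schwartz functions. -/
noncomputable def tensor (φ ψ : 𝓢(Pos m, ℂ)) : 𝓢(Pos m × Pos m, ℂ) where
  toFun z := φ z.1 * ψ z.2
  smooth' := ((φ.smooth ⊤).comp contDiff_fst).mul ((ψ.smooth ⊤).comp contDiff_snd)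
  decay' k n := tensor_decay φ ψ k n

/-- `T` is the Schwartz kernel of `A`: the tempered distribution on `ℝ^m × ℝ^m` with
`⟨φ, A ψ⟩ = T (conj φ ⊗ ψ)` for all Schwartz functions `φ`, `ψ`. -/
def IsSchwartzKernel (A : L2 m →L[ℂ] L2 m) (T : 𝓢'(Pos m × Pos m, ℂ)) : Prop :=
  ∀ φ ψ : 𝓢(Pos m, ℂ),
    inner ℂ (φ.toLp 2 (volume : Measure (Pos m))) (A (ψ.toLp 2 (volume : Measure (Pos m)))) =
      T (tensor (conjSchwartz φ) ψ)

/-- The change of variables `τ(x, y) = (y + x/2, y - x/2)`, with inverse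
`τ⁻¹(u, v) = (u - v, (u + v)/2)`. -/
noncomputable def tau (m : ℕ) : (Pos m × Pos m) ≃L[ℝ] (Pos m × Pos m) :=
  ContinuousLinearEquiv.equivOfInverse
    (((ContinuousLinearMap.snd ℝ (Pos m) (Pos m)) +
        (1 / 2 : ℝ) • (ContinuousLinearMap.fst ℝ (Pos m) (Pos m))).prod
      ((ContinuousLinearMap.snd ℝ (Pos m) (Pos m)) -
        (1 / 2 : ℝ) • (ContinuousLinearMap.fst ℝ (Pos m) (Pos m))))
    (((ContinuousLinearMap.fst ℝ (Pos m) (Pos m)) -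
        (ContinuousLinearMap.snd ℝ (Pos m) (Pos m))).prod
      ((1 / 2 : ℝ) • ((ContinuousLinearMap.fst ℝ (Pos m) (Pos m)) +
        (ContinuousLinearMap.snd ℝ (Pos m) (Pos m)))))
    (fun z => by
      ext i
      · simp; ring
      · simp; ring)
    (fun z => by
      ext i
      · simp; ring
      · simp; ring)

theorem tau_apply (x y : Pos m) :
    tau m (x, y) = (y + (1 / 2 : ℝ) • x, y - (1 / 2 : ℝ) • x) := rfl

theorem tau_symm_apply (u v : Pos m) :
    (tau m).symm (u, v) = (u - v, (1 / 2 : ℝ) • (u + v)) := rfl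

/-- `τ` preserves Lebesgue measure (its determinant is `1`), so that no Jacobian factor appears
in the composition of a distribution with `τ`. -/
theorem measurePreserving_tau (m : ℕ) :
    MeasurePreserving (tau m) (volume : Measure (Pos m × Pos m)) volume := by
  have hA : MeasurePreserving (fun z : Pos m × Pos m => (z.1, z.2 - (1 / 2 : ℝ) • z.1))
      volume volume :=
    MeasurePreserving.skew_product (f := id) (g := fun x y : Pos m => y - (1 / 2 : ℝ) • x)
      (MeasurePreserving.id volume) (by unfold Function.uncurry; fun_prop)
      (Filter.Eventually.of_forall fun x => (measurePreserving_sub_right volume _).map_eq)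
  have hS : MeasurePreserving (Prod.swap : Pos m × Pos m → Pos m × Pos m) volume volume :=
    Measure.measurePreserving_swap
  have hB : MeasurePreserving (fun z : Pos m × Pos m => (z.1, z.1 + z.2)) volume volume :=
    measurePreserving_prod_add volume volume
  have h := hS.comp (hB.comp (hS.comp hA))
  convert h using 1
  funext z
  refine Prod.ext ?_ rfl
  ext i
  have e : tau m z = (z.2 + (1 / 2 : ℝ) • z.1, z.2 - (1 / 2 : ℝ) • z.1) := rfl
  simp [e]
  ring

/-- The composition `T ∘ τ` of a tempered distribution with `τ`: since `|det τ| = 1`, it is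
`f ↦ T (f ∘ τ⁻¹)`. -/
noncomputable def compTau (T : 𝓢'(Pos m × Pos m, ℂ)) : 𝓢'(Pos m × Pos m, ℂ) :=
  PointwiseConvergenceCLM.precomp ℂ
    (SchwartzMap.compCLMOfContinuousLinearEquiv ℂ (tau m).symm) T

theorem compTau_apply (T : 𝓢'(Pos m × Pos m, ℂ)) (f : 𝓢(Pos m × Pos m, ℂ)) :
    compTau T f = T (SchwartzMap.compCLMOfContinuousLinearEquiv ℂ (tau m).symm f) := rfl

/-- The partial Fourier transform in the first variable is a continuous operator on Schwartz
functions. -/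
theorem exists_partialFourier (m : ℕ) :
    ∃ L : 𝓢(Pos m × Pos m, ℂ) →L[ℂ] 𝓢(Pos m × Pos m, ℂ), ∀ f u y,
      L f (u, y) = (((2 * Real.pi) ^ (-(m : ℝ) / 2) : ℝ) : ℂ) *
        ∫ a : Pos m, f (a, y) * Complex.exp (-Complex.I * ((inner ℝ a u : ℝ) : ℂ)) := by
  obtain ⟨P, hP⟩ := PartialFourier.exists_pfunCLM (V := Pos m)
  have h2 : (2 * Real.pi)⁻¹ ≠ 0 := by positivity
  let e : (Pos m × Pos m) ≃L[ℝ] (Pos m × Pos m) :=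
    (ContinuousLinearEquiv.smulLeft (Units.mk0 ((2 * Real.pi)⁻¹ : ℝ) h2)).prodCongr
      (ContinuousLinearEquiv.refl ℝ (Pos m))
  refine ⟨(((2 * Real.pi) ^ (-(m : ℝ) / 2) : ℝ) : ℂ) •
    (SchwartzMap.compCLMOfContinuousLinearEquiv ℂ e ∘L P), fun f u y => ?_⟩
  have he : e (u, y) = ((2 * Real.pi)⁻¹ • u, y) := rfl
  simp only [smul_apply, ContinuousLinearMap.comp_apply,
    SchwartzMap.compCLMOfContinuousLinearEquiv_apply, Function.comp_apply, smul_eq_mul, he, hP]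
  congr 1
  unfold PartialFourier.pfun
  congr 1
  funext a
  simp only [PartialFourier.integrand, Real.fourierChar_apply, smul_eq_mul, inner_smul_right]
  rw [mul_comm]
  congr 2
  push_cast
  have : (Real.pi : ℂ) ≠ 0 := by exact_mod_cast Real.pi_ne_zero
  field_simp

/-- The partial Fourier transform `𝓕_I` on Schwartz functions,
`(𝓕_I f)(u, y) = (2π)^{-m/2} ∫ f(a, y) exp (-i a·u) da`. -/
noncomputable def partialFourier (m : ℕ) : 𝓢(Pos m × Pos m, ℂ) →L[ℂ] 𝓢(Pos m × Pos m, ℂ) :=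
  Classical.choose (exists_partialFourier m)

theorem partialFourier_apply (f : 𝓢(Pos m × Pos m, ℂ)) (u y : Pos m) :
    partialFourier m f (u, y) = (((2 * Real.pi) ^ (-(m : ℝ) / 2) : ℝ) : ℂ) *
      ∫ a : Pos m, f (a, y) * Complex.exp (-Complex.I * ((inner ℝ a u : ℝ) : ℂ)) :=
  Classical.choose_spec (exists_partialFourier m) f u y

/-- The partial Fourier transform of a tempered distribution, by duality:
`(𝓕_I T)(f) = T (𝓕_I f)`. -/
noncomputable def partialFourierDistribution (T : 𝓢'(Pos m × Pos m, ℂ)) :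
    𝓢'(Pos m × Pos m, ℂ) :=
  PointwiseConvergenceCLM.precomp ℂ (partialFourier m) T

theorem partialFourierDistribution_apply (T : 𝓢'(Pos m × Pos m, ℂ))
    (f : 𝓢(Pos m × Pos m, ℂ)) : partialFourierDistribution T f = T (partialFourier m f) := rfl

/-- The Schwartz function `w ↦ g (z - w)`. -/
noncomputable def reflectTranslate (g : 𝓢(Pos m × Pos m, ℂ)) (z : Pos m × Pos m) :
    𝓢(Pos m × Pos m, ℂ) :=
  SchwartzMap.compSubConstCLM ℂ z
    (SchwartzMap.compCLMOfContinuousLinearEquiv ℂ (ContinuousLinearEquiv.neg ℝ) g)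

theorem reflectTranslate_apply (g : 𝓢(Pos m × Pos m, ℂ)) (z w : Pos m × Pos m) :
    reflectTranslate g z w = g (z - w) := by
  simp [reflectTranslate]

/-- The convolution of a Schwartz function with a tempered distribution on `ℝ^{2m}`, a function,
for the normalization `(f ∗ g)(z) = (2π)^{-2m/2} ∫ f(w) g(z - w) dw` on `ℝ^{2m}`:
`(g ∗ T)(z) = (2π)^{-m} T(g(z - ·))`. -/
noncomputable def convolveDistribution (g : 𝓢(Pos m × Pos m, ℂ)) (T : 𝓢'(Pos m × Pos m, ℂ))
    (z : Pos m × Pos m) : ℂ :=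
  ((1 / (2 * Real.pi) ^ m : ℝ) : ℂ) * T (reflectTranslate g z)

/-- The tempered distribution `T` is regular and given by the function `K`: `K` is locally
integrable and `T f = ∫ K f` for all smooth compactly supported `f`. -/
def IsRegularWith (T : 𝓢'(Pos m × Pos m, ℂ)) (K : Pos m × Pos m → ℂ) : Prop :=
  LocallyIntegrable K volume ∧
    ∀ f : 𝓢(Pos m × Pos m, ℂ), HasCompactSupport f → T f = ∫ z, K z * f z

/-- The integrand `K(b + t/2, b - t/2) exp (-(‖p - a‖² + ‖q - b‖²)) exp (-i t·a)`. -/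
noncomputable def tripleIntegrand (K : Pos m × Pos m → ℂ) (q p t a b : Pos m) : ℂ :=
  K (b + (1 / 2 : ℝ) • t, b - (1 / 2 : ℝ) • t) *
    ((Real.exp (-(‖p - a‖ ^ 2 + ‖q - b‖ ^ 2)) : ℝ) : ℂ) *
    Complex.exp (-Complex.I * ((inner ℝ t a : ℝ) : ℂ))

end PhaseSpace

open PhaseSpace
open scoped Topology

/-!
The expected value `⟨A⟩(q, p)` is the Schwartz kernel of `A` tested against the Gaussian
`conj ϑ_{qp} ⊗ ϑ_{qp}`, and everything rests on two ways of writing this one test function,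
`coherentTest q p`. By the parallelogram identity and the Gaussian Fourier integral it equals
`(2π)^{m/2} 𝓕_I[ω((p, q) - ·)] ∘ τ⁻¹` (`coherentTest_apply`), and pairing this with the kernel is
the convolution formula. By the same Gaussian integral, integrating the triple integrand over `a`
produces `π^m (K · coherentTest q p) ∘ τ` (`integral_tripleIntegrand_inner`).

For a regular kernel, `T f = ∫ K f` is known only for compactly supported `f`. Since
`χ (ε ·) F → F` in the Schwartz space (`tendsto_cutoff`), continuity of `T` gives the regularized
formula. If `K · coherentTest q p` is integrable, dominated convergence removes the cut-off
(`apply_coherentTest_eq_integral`), and Fubini's theorem treats the absolutely convergent case.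

The Schwartz kernel exists without a general kernel theorem, because `A` is bounded. With
`w(x) = (1 + ‖x‖²)^{m+1}`, the damped plane waves `wave η = w⁻¹ exp (2πi ⟪η, ·⟫)` lie in `L²`, have
constant norm and depend continuously on `η`. By Fourier inversion every Schwartz function `φ` is
the superposition of the vectors `wave η` with coefficients `𝓕 (w φ) η`. Therefore
`F ↦ ∫ 𝓕 ((w ⊗ w) F)(ξ, η) ⟪wave (-ξ), A (wave η)⟫ d(ξ, η)` is a tempered distribution, the
second factor being bounded and continuous, and it is the kernel of `A`
(`integral_tensor_fourier_mul_waveSymbol`).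
-/

namespace PhaseSpace

/-! ### Cut-offs of Schwartz functions -/

section Cutoff

variable {E : Type} [NormedAddCommGroup E] [NormedSpace ℝ E]

theorem hasTemperateGrowth_dilate (χ : 𝓢(E, ℂ)) (ε : ℝ) :
    (fun z => χ (ε • z)).HasTemperateGrowth :=
  χ.hasTemperateGrowth.comp (ε • ContinuousLinearMap.id ℝ E).hasTemperateGrowth

/-- The product `z ↦ χ (ε z) F z` of a Schwartz function `F` with a dilated cut-off. -/
noncomputable def cutoff (χ F : 𝓢(E, ℂ)) (ε : ℝ) : 𝓢(E, ℂ) :=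
  smulLeftCLM ℂ (fun z => χ (ε • z)) F

theorem cutoff_apply (χ F : 𝓢(E, ℂ)) (ε : ℝ) (z : E) : cutoff χ F ε z = χ (ε • z) * F z :=
  smulLeftCLM_apply_apply (hasTemperateGrowth_dilate χ ε) F z

theorem HasCompactSupport.dilate {χ : E → ℂ} (hχ : HasCompactSupport χ) {ε : ℝ} (hε : ε ≠ 0) :
    HasCompactSupport fun z => χ (ε • z) :=
  hχ.comp_homeomorph (Homeomorph.smulOfNeZero ε hε)

theorem hasCompactSupport_cutoff {χ : 𝓢(E, ℂ)} (hχ : HasCompactSupport χ) (F : 𝓢(E, ℂ)) {ε : ℝ}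
    (hε : ε ≠ 0) : HasCompactSupport (cutoff χ F ε) := by
  have h : HasCompactSupport fun z => χ (ε • z) * F z := (HasCompactSupport.dilate hχ hε).mul_right
  convert h using 1
  funext z
  exact cutoff_apply χ F ε z

/-- The error `χ (ε z) - 1` of a dilated cut-off and all its derivatives are `O(ε (1 + ‖z‖))`. -/
theorem norm_iteratedFDeriv_dilate_sub_one_le (χ : 𝓢(E, ℂ)) (h0 : χ 0 = 1) (i : ℕ) :
    ∃ C : ℝ, 0 ≤ C ∧ ∀ ε : ℝ, 0 < ε → ε ≤ 1 → ∀ z : E,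
      ‖iteratedFDeriv ℝ i (fun z => χ (ε • z) - 1) z‖ ≤ ε * C * (1 + ‖z‖) := by
  rcases Nat.eq_zero_or_pos i with rfl | hi
  · refine ⟨SchwartzMap.seminorm ℝ 0 1 χ, by positivity, fun ε hε _ z => ?_⟩
    have h := convex_univ.norm_image_sub_le_of_norm_fderiv_le (𝕜 := ℝ) (f := χ)
      (C := SchwartzMap.seminorm ℝ 0 1 χ) (x := 0) (y := ε • z)
      (fun x _ => χ.differentiableAt) (fun x _ => by
        rw [← norm_iteratedFDeriv_one]
        exact norm_iteratedFDeriv_le_seminorm ℝ χ 1 x) trivial trivial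
    rw [h0, sub_zero, norm_smul, Real.norm_of_nonneg hε.le] at h
    rw [norm_iteratedFDeriv_zero]
    refine h.trans ?_
    have : 0 ≤ SchwartzMap.seminorm ℝ 0 1 χ := by positivity
    nlinarith [mul_nonneg this hε.le]
  · refine ⟨SchwartzMap.seminorm ℝ 0 i χ, by positivity, fun ε hε h1 z => ?_⟩
    have hd : ContDiff ℝ i (fun z => χ (ε • z)) :=
      (χ.smooth i).comp (contDiff_const_smul ε)
    have e : iteratedFDeriv ℝ i (fun z => χ (ε • z) - 1) z =
        ε ^ i • iteratedFDeriv ℝ i χ (ε • z) := by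
      have := iteratedFDeriv_sub_apply (x := z) hd.contDiffAt
        (contDiff_const (c := (1 : ℂ)) (n := i)).contDiffAt
      have h3 := iteratedFDeriv_comp_const_smul ε (χ.smooth i)
      rw [iteratedFDeriv_const_of_ne hi.ne', Pi.zero_apply, sub_zero] at this
      exact this.trans (congrFun h3 z)
    rw [e, norm_smul, norm_pow, Real.norm_of_nonneg hε.le]
    have a1 : ε ^ i ≤ ε := pow_le_of_le_one hε.le h1 hi.ne'
    have a2 := norm_iteratedFDeriv_le_seminorm ℝ χ i (ε • z)
    calc _ ≤ ε * SchwartzMap.seminorm ℝ 0 i χ := by gcongr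
      _ ≤ _ := le_mul_of_one_le_right (by positivity) (by linarith [norm_nonneg z])

/-- Removing the cut-off: `χ (ε ·) F → F` in the Schwartz space as `ε → 0⁺`, if `χ 0 = 1`. -/
theorem tendsto_cutoff (χ F : 𝓢(E, ℂ)) (h0 : χ 0 = 1) :
    Filter.Tendsto (cutoff χ F) (𝓝[>] 0) (𝓝 F) := by
  rw [(schwartz_withSeminorms ℝ E ℂ).tendsto_nhds]
  rintro ⟨k, n⟩ δ hδ
  choose C hC hb using norm_iteratedFDeriv_dilate_sub_one_le χ h0
  set M : ℝ := ∑ i ∈ Finset.range (n + 1), (n.choose i : ℝ) * (C i *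
    (SchwartzMap.seminorm ℝ k (n - i) F + SchwartzMap.seminorm ℝ (k + 1) (n - i) F)) with hM
  have hM0 : 0 ≤ M := Finset.sum_nonneg fun i _ => by have := hC i; positivity
  have key : ∀ ε : ℝ, 0 < ε → ε ≤ 1 →
      SchwartzMap.seminorm ℝ k n (cutoff χ F ε - F) ≤ ε * M := by
    intro ε hε h1
    refine SchwartzMap.seminorm_le_bound ℝ k n _ (by positivity) fun z => ?_
    have e : ⇑(cutoff χ F ε - F) = fun z => (χ (ε • z) - 1) * F z := by
      funext z
      rw [sub_apply, cutoff_apply]; ring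
    have hd : ContDiff ℝ n (fun z => χ (ε • z) - 1) :=
      ((χ.smooth n).comp (contDiff_const_smul ε)).sub contDiff_const
    rw [e]
    have h := norm_iteratedFDeriv_mul_le (A := ℂ) hd (F.smooth n) z (n := n) le_rfl
    refine (mul_le_mul_of_nonneg_left h (by positivity)).trans ?_
    rw [Finset.mul_sum, hM, Finset.mul_sum]
    refine Finset.sum_le_sum fun i _ => ?_
    have b1 := SchwartzMap.le_seminorm ℝ k (n - i) F z
    have b2 := SchwartzMap.le_seminorm ℝ (k + 1) (n - i) F z
    have hCi := hC i
    calc _ ≤ ‖z‖ ^ k * ((n.choose i : ℝ) * (ε * C i * (1 + ‖z‖)) *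
          ‖iteratedFDeriv ℝ (n - i) F z‖) := by
          gcongr
          exact hb i ε hε h1 z
      _ = ε * ((n.choose i : ℝ) * (C i * (‖z‖ ^ k * ‖iteratedFDeriv ℝ (n - i) F z‖ +
          ‖z‖ ^ (k + 1) * ‖iteratedFDeriv ℝ (n - i) F z‖))) := by ring
      _ ≤ _ := by gcongr
  have hmem : ∀ᶠ ε : ℝ in 𝓝[>] 0, 0 < ε ∧ ε < 1 ∧ ε < δ / (M + 1) :=
    Filter.eventually_of_mem (Ioo_mem_nhdsGT (show (0 : ℝ) < min 1 (δ / (M + 1)) by positivity))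
      fun ε hε => ⟨hε.1, (lt_min_iff.1 hε.2).1, (lt_min_iff.1 hε.2).2⟩
  filter_upwards [hmem] with ε hε
  refine (key ε hε.1 hε.2.1.le).trans_lt ?_
  have := (lt_div_iff₀ (by positivity)).1 hε.2.2
  nlinarith [hε.1]

theorem exists_cutoff [FiniteDimensional ℝ E] :
    ∃ χ : 𝓢(E, ℂ), HasCompactSupport χ ∧ χ 0 = 1 := by
  obtain ⟨f, -, hc, hs, -, h1⟩ := exists_contDiff_tsupport_subset (E := E) (x := 0) (n := ⊤)
    Filter.univ_mem
  have hc' : HasCompactSupport fun z => (f z : ℂ) := hc.comp_left Complex.ofReal_zero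
  refine ⟨hc'.toSchwartzMap (Complex.ofRealCLM.contDiff.comp hs), hc', ?_⟩
  change (f 0 : ℂ) = 1
  rw [h1, Complex.ofReal_one]

end Cutoff

/-! ### The Gaussian integral and the coherent states -/

section CoherentState

variable {m : ℕ}

theorem sqrt_pi_pow_mul_self : Real.pi ^ ((m : ℝ) / 2) * Real.pi ^ ((m : ℝ) / 2) = Real.pi ^ m := by
  rw [← Real.rpow_add Real.pi_pos, add_halves, Real.rpow_natCast]

theorem gaussian_mul_phase_eq (p t v : Pos m) :
    ((Real.exp (-‖p - (v + p)‖ ^ 2) : ℝ) : ℂ) *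
        Complex.exp (-Complex.I * ((inner ℝ t (v + p) : ℝ) : ℂ)) =
      Complex.exp (-Complex.I * ((inner ℝ t p : ℝ) : ℂ)) *
        Complex.exp (-1 * (‖v‖ : ℂ) ^ 2 + -Complex.I * ((inner ℝ t v : ℝ) : ℂ)) := by
  rw [Complex.ofReal_exp, ← Complex.exp_add, ← Complex.exp_add]
  have e : p - (v + p) = -v := by abel
  rw [e, norm_neg, inner_add_right]
  congr 1
  push_cast
  ring

theorem integrable_gaussian_mul_phase (p t : Pos m) :
    Integrable fun a : Pos m => ((Real.exp (-‖p - a‖ ^ 2) : ℝ) : ℂ) *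
      Complex.exp (-Complex.I * ((inner ℝ t a : ℝ) : ℂ)) := by
  have h := ((GaussianFourier.integrable_cexp_neg_mul_sq_norm_add (V := Pos m) (b := 1)
    (by simp) (-Complex.I) t).const_mul
      (Complex.exp (-Complex.I * ((inner ℝ t p : ℝ) : ℂ)))).comp_sub_right p
  refine h.congr (Filter.Eventually.of_forall fun a => ?_)
  simp only
  rw [← gaussian_mul_phase_eq, sub_add_cancel]

/-- The Fourier transform of the Gaussian centred at `p`. -/
theorem integral_gaussian_mul_phase (p t : Pos m) :
    ∫ a : Pos m, ((Real.exp (-‖p - a‖ ^ 2) : ℝ) : ℂ) *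
        Complex.exp (-Complex.I * ((inner ℝ t a : ℝ) : ℂ)) =
      ((Real.pi ^ ((m : ℝ) / 2) * Real.exp (-(‖t‖ ^ 2 / 4)) : ℝ) : ℂ) *
        Complex.exp (-Complex.I * ((inner ℝ t p : ℝ) : ℂ)) := by
  rw [← integral_add_right_eq_self _ p]
  simp only [gaussian_mul_phase_eq]
  rw [integral_const_mul, GaussianFourier.integral_cexp_neg_mul_sq_norm_add (by simp)]
  rw [mul_comm]
  congr 1
  push_cast
  rw [Complex.ofReal_cpow Real.pi_pos.le]
  simp only [finrank_euclideanSpace, Fintype.card_fin, div_one]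
  push_cast
  congr 2
  rw [neg_sq, Complex.I_sq]
  ring

/-- The parallelogram identity behind the change of variables `τ`. -/
theorem norm_sq_add_norm_sq_midpoint (q u v : Pos m) :
    ‖q - (1 / 2 : ℝ) • (u + v)‖ ^ 2 + ‖u - v‖ ^ 2 / 4 = (‖u - q‖ ^ 2 + ‖v - q‖ ^ 2) / 2 := by
  have e1 : q - (1 / 2 : ℝ) • (u + v) = -((1 / 2 : ℝ) • ((u - q) + (v - q))) := by
    module
  have e2 : u - v = (u - q) - (v - q) := by abel
  have h := parallelogram_law_with_norm ℝ (u - q) (v - q)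
  rw [e1, e2, norm_neg, norm_smul, Real.norm_of_nonneg (by norm_num : (0 : ℝ) ≤ 1 / 2)]
  nlinarith

theorem star_theta_mul_theta (q p u v : Pos m) :
    starRingEnd ℂ (theta q p u) * theta q p v =
      (((Real.pi ^ ((m : ℝ) / 2))⁻¹ *
        Real.exp (-(‖q - (1 / 2 : ℝ) • (u + v)‖ ^ 2 + ‖u - v‖ ^ 2 / 4)) : ℝ) : ℂ) *
        Complex.exp (-Complex.I * ((inner ℝ (u - v) p : ℝ) : ℂ)) := by
  have hπ : (Real.pi ^ ((m : ℝ) / 2))⁻¹ =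
      1 / Real.pi ^ ((m : ℝ) / 4) * (1 / Real.pi ^ ((m : ℝ) / 4)) := by
    rw [one_div, ← mul_inv, ← Real.rpow_add Real.pi_pos]
    ring_nf
  rw [norm_sq_add_norm_sq_midpoint, hπ]
  unfold theta
  simp only [map_mul, Complex.conj_ofReal, ← Complex.exp_conj, Complex.conj_I]
  set c : ℂ := ((1 / Real.pi ^ ((m : ℝ) / 4) : ℝ) : ℂ) with hc
  have hre : Real.exp (-((‖u - q‖ ^ 2 + ‖v - q‖ ^ 2) / 2)) =
      Real.exp (-(1 / 2) * ‖u - q‖ ^ 2) * Real.exp (-(1 / 2) * ‖v - q‖ ^ 2) := by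
    rw [← Real.exp_add]; ring_nf
  have hph : Complex.exp (-Complex.I * ((inner ℝ (u - v) p : ℝ) : ℂ)) =
      Complex.exp (-Complex.I * ((inner ℝ p (u - (1 / 2 : ℝ) • q) : ℝ) : ℂ)) *
      Complex.exp (Complex.I * ((inner ℝ p (v - (1 / 2 : ℝ) • q) : ℝ) : ℂ)) := by
    rw [← Complex.exp_add, real_inner_comm, inner_sub_right, inner_sub_right, inner_sub_right]
    congr 1
    push_cast
    ring
  rw [hre, hph]
  push_cast [hc]
  ring

theorem theta_center_ne_zero (q p : Pos m) : theta q p q ≠ 0 := by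
  unfold theta
  have : (0 : ℝ) < Real.pi ^ ((m : ℝ) / 4) := Real.rpow_pos_of_pos Real.pi_pos _
  refine mul_ne_zero (mul_ne_zero ?_ (Complex.exp_ne_zero _)) ?_
  · exact_mod_cast (one_div_pos.2 this).ne'
  · exact_mod_cast (Real.exp_pos _).ne'

/-- The Gaussian `(2π)^{m/2} 𝓕_I[ω((p, q) - ·)] ∘ τ⁻¹`, the test function on which the kernel
of `A` is evaluated by the convolution formula. -/
noncomputable def coherentTest (q p : Pos m) : 𝓢(Pos m × Pos m, ℂ) :=
  (((2 * Real.pi) ^ ((m : ℝ) / 2) : ℝ) : ℂ) •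
    SchwartzMap.compCLMOfContinuousLinearEquiv ℂ (tau m).symm
      (partialFourier m (reflectTranslate (omega m) (p, q)))

theorem coherentTest_apply (q p u v : Pos m) :
    coherentTest q p (u, v) = starRingEnd ℂ (theta q p u) * theta q p v := by
  have hI : ∀ a : Pos m, reflectTranslate (omega m) (p, q) (a, (1 / 2 : ℝ) • (u + v)) *
      Complex.exp (-Complex.I * ((inner ℝ a (u - v) : ℝ) : ℂ)) =
      ((1 / Real.pi ^ m * Real.exp (-‖q - (1 / 2 : ℝ) • (u + v)‖ ^ 2) : ℝ) : ℂ) *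
        (((Real.exp (-‖p - a‖ ^ 2) : ℝ) : ℂ) *
          Complex.exp (-Complex.I * ((inner ℝ (u - v) a : ℝ) : ℂ))) := by
    intro a
    rw [reflectTranslate_apply, Prod.mk_sub_mk, omega_apply, neg_add, Real.exp_add,
      real_inner_comm]
    push_cast
    ring
  have h2 : (2 * Real.pi) ^ ((m : ℝ) / 2) * (2 * Real.pi) ^ (-(m : ℝ) / 2) = 1 := by
    rw [← Real.rpow_add (by positivity)]
    ring_nf
    exact Real.rpow_zero _
  rw [coherentTest, smul_apply, SchwartzMap.compCLMOfContinuousLinearEquiv_apply,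
    Function.comp_apply, tau_symm_apply, partialFourier_apply, smul_eq_mul, ← mul_assoc,
    ← Complex.ofReal_mul, h2, Complex.ofReal_one, one_mul]
  simp only [hI]
  rw [integral_const_mul, integral_gaussian_mul_phase, star_theta_mul_theta, ← mul_assoc,
    ← Complex.ofReal_mul]
  congr 2
  have hp : 0 < Real.pi ^ ((m : ℝ) / 2) := Real.rpow_pos_of_pos Real.pi_pos _
  rw [neg_add, Real.exp_add, ← sqrt_pi_pow_mul_self]
  field_simp

theorem hasTemperateGrowth_prodMk (q : Pos m) :
    (fun x : Pos m => (q, x)).HasTemperateGrowth := by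
  have h := (ContinuousLinearMap.inr ℝ (Pos m) (Pos m)).hasTemperateGrowth.add
    (Function.HasTemperateGrowth.const (q, (0 : Pos m)))
  convert h using 1
  funext x
  simp

/-- The coherent state `ϑ_{qp}` as a Schwartz function. Up to a constant it is the slice
`coherentTest q p (q, ·)`, which makes its decay evident. -/
noncomputable def thetaSchwartz (q p : Pos m) : 𝓢(Pos m, ℂ) :=
  (starRingEnd ℂ (theta q p q))⁻¹ •
    SchwartzMap.compCLMOfAntilipschitz ℂ (K := 1) (g := fun x : Pos m => (q, x))
      (hasTemperateGrowth_prodMk q)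
      (AntilipschitzWith.of_le_mul_dist fun x y => by simp [Prod.dist_eq])
      (coherentTest q p)

theorem thetaSchwartz_apply (q p x : Pos m) : thetaSchwartz q p x = theta q p x := by
  have h : starRingEnd ℂ (theta q p q) ≠ 0 := by simpa using theta_center_ne_zero q p
  rw [thetaSchwartz, smul_apply, SchwartzMap.compCLMOfAntilipschitz_apply, Function.comp_apply,
    coherentTest_apply, smul_eq_mul, inv_mul_cancel_left₀ h]

theorem coherentTest_eq_tensor (q p : Pos m) :
    coherentTest q p = tensor (conjSchwartz (thetaSchwartz q p)) (thetaSchwartz q p) := by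
  ext ⟨u, v⟩
  rw [coherentTest_apply]
  change _ = starRingEnd ℂ (thetaSchwartz q p u) * thetaSchwartz q p v
  rw [thetaSchwartz_apply, thetaSchwartz_apply]

theorem toLp_thetaSchwartz (q p : Pos m) :
    (thetaSchwartz q p).toLp 2 (volume : Measure (Pos m)) = fundamentalState q p := by
  rw [SchwartzMap.toLp, fundamentalState]
  congr 1
  funext x
  exact thetaSchwartz_apply q p x

theorem expectedValue_eq_apply_coherentTest {A : L2 m →L[ℂ] L2 m} {T : 𝓢'(Pos m × Pos m, ℂ)}
    (hT : IsSchwartzKernel A T) (q p : Pos m) : expectedValue A q p = T (coherentTest q p) := by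
  rw [expectedValue, ← toLp_thetaSchwartz, hT, coherentTest_eq_tensor]

theorem expectedValue_eq_convolution {A : L2 m →L[ℂ] L2 m} {T : 𝓢'(Pos m × Pos m, ℂ)}
    (hT : IsSchwartzKernel A T) (q p : Pos m) :
    expectedValue A q p = (((2 * Real.pi) ^ (3 * (m : ℝ) / 2) : ℝ) : ℂ) *
      convolveDistribution (omega m) (partialFourierDistribution (compTau T)) (p, q) := by
  rw [expectedValue_eq_apply_coherentTest hT, convolveDistribution,
    partialFourierDistribution_apply, compTau_apply, coherentTest, map_smul, smul_eq_mul,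
    ← mul_assoc, ← Complex.ofReal_mul]
  congr 2
  have e : 3 * (m : ℝ) / 2 = (m : ℝ) / 2 + m := by ring
  rw [e, Real.rpow_add (by positivity), Real.rpow_natCast, mul_assoc, mul_one_div_cancel,
    mul_one]
  positivity

end CoherentState

/-! ### The regular case -/

section Regular

variable {m : ℕ}

/-- The integral over `a` replaces the Gaussian by the test function `coherentTest q p`. -/
theorem integral_tripleIntegrand_inner (K : Pos m × Pos m → ℂ) (q p : Pos m)
    (z : Pos m × Pos m) :
    ∫ a : Pos m, tripleIntegrand K q p z.1 a z.2 =
      ((Real.pi ^ m : ℝ) : ℂ) * (K (tau m z) * coherentTest q p (tau m z)) := by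
  obtain ⟨t, b⟩ := z
  have h : ∀ a : Pos m, tripleIntegrand K q p t a b =
      (K (tau m (t, b)) * ((Real.exp (-‖q - b‖ ^ 2) : ℝ) : ℂ)) *
      (((Real.exp (-‖p - a‖ ^ 2) : ℝ) : ℂ) *
        Complex.exp (-Complex.I * ((inner ℝ t a : ℝ) : ℂ))) := by
    intro a
    simp only [tripleIntegrand, tau_apply, neg_add, Real.exp_add]
    push_cast
    ring
  have e1 : (b + (1 / 2 : ℝ) • t) - (b - (1 / 2 : ℝ) • t) = t := by module
  have e2 : (1 / 2 : ℝ) • ((b + (1 / 2 : ℝ) • t) + (b - (1 / 2 : ℝ) • t)) = b := by module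
  simp only [h]
  rw [integral_const_mul, integral_gaussian_mul_phase, tau_apply, coherentTest_apply,
    star_theta_mul_theta, e1, e2, neg_add, Real.exp_add, ← sqrt_pi_pow_mul_self]
  have hp : ((Real.pi ^ ((m : ℝ) / 2) : ℝ) : ℂ) ≠ 0 :=
    mod_cast (Real.rpow_pos_of_pos Real.pi_pos _).ne'
  push_cast at hp ⊢
  field_simp

/-- The rearrangement `((t, b), a) ↦ (t, a, b)`. -/
def shuffle (m : ℕ) : (Pos m × Pos m) × Pos m ≃ᵐ Pos m × Pos m × Pos m :=
  MeasurableEquiv.prodAssoc.trans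
    ((MeasurableEquiv.refl (Pos m)).prodCongr MeasurableEquiv.prodComm)

theorem shuffle_apply (z : Pos m × Pos m) (a : Pos m) : shuffle m (z, a) = (z.1, a, z.2) := rfl

theorem measurePreserving_shuffle (m : ℕ) :
    MeasurePreserving (shuffle m) (volume : Measure ((Pos m × Pos m) × Pos m)) volume :=
  ((MeasurePreserving.id volume).prod Measure.measurePreserving_swap).comp
    volume_preserving_prodAssoc

theorem aestronglyMeasurable_comp_tau {K : Pos m × Pos m → ℂ}
    (hK : AEStronglyMeasurable K volume) : AEStronglyMeasurable (fun z => K (tau m z)) volume :=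
  hK.comp_measurePreserving (measurePreserving_tau m)

theorem integrable_comp_tau {f : Pos m × Pos m → ℂ} :
    Integrable (fun z => f (tau m z)) ↔ Integrable f :=
  (measurePreserving_tau m).integrable_comp_emb (tau m).toHomeomorph.measurableEmbedding

theorem integral_comp_tau (f : Pos m × Pos m → ℂ) : ∫ z, f (tau m z) = ∫ z, f z :=
  (measurePreserving_tau m).integral_comp (tau m).toHomeomorph.measurableEmbedding f

theorem norm_tripleIntegrand (K : Pos m × Pos m → ℂ) (q p t a b : Pos m) :
    ‖tripleIntegrand K q p t a b‖ =
      ‖K (tau m (t, b))‖ * (Real.exp (-‖q - b‖ ^ 2) * Real.exp (-‖p - a‖ ^ 2)) := by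
  have e : ‖Complex.exp (-Complex.I * ((inner ℝ t a : ℝ) : ℂ))‖ = 1 := by
    rw [Complex.norm_exp]; simp
  rw [tripleIntegrand, norm_mul, norm_mul, e, mul_one, Complex.norm_real,
    Real.norm_of_nonneg (Real.exp_pos _).le, neg_add, Real.exp_add, tau_apply,
    mul_comm (Real.exp (-‖p - a‖ ^ 2))]

theorem integrable_gaussian (p : Pos m) :
    Integrable fun a : Pos m => Real.exp (-‖p - a‖ ^ 2) := by
  have h := (integrable_gaussian_mul_phase p (0 : Pos m)).norm
  refine h.congr (Filter.Eventually.of_forall fun a => ?_)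
  simp only [inner_zero_left, Complex.ofReal_zero, mul_zero, Complex.exp_zero, mul_one,
    Complex.norm_real, Real.norm_of_nonneg (Real.exp_pos _).le]

/-- A function of `(t, b)` that makes `K ∘ τ` integrable makes the triple integral absolutely
convergent. -/
theorem integrable_mul_tripleIntegrand {K : Pos m × Pos m → ℂ}
    (hK : AEStronglyMeasurable K volume) {c : Pos m × Pos m → ℂ} (hc : Continuous c)
    (h : Integrable fun z => c z * K (tau m z)) (q p : Pos m) :
    Integrable fun x : Pos m × Pos m × Pos m =>
      c (x.1, x.2.2) * tripleIntegrand K q p x.1 x.2.1 x.2.2 := by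
  rw [← (measurePreserving_shuffle m).integrable_comp_emb (shuffle m).measurableEmbedding]
  have hg : Integrable (fun y : (Pos m × Pos m) × Pos m =>
      ‖c y.1 * K (tau m y.1)‖ * Real.exp (-‖p - y.2‖ ^ 2)) volume :=
    h.norm.mul_prod (integrable_gaussian p)
  refine hg.mono' ?_ (Filter.Eventually.of_forall fun y => ?_)
  · have h1 : AEStronglyMeasurable (fun y : (Pos m × Pos m) × Pos m => K (tau m y.1))
        volume := (aestronglyMeasurable_comp_tau hK).comp_fst
    have h2 : Continuous fun y : (Pos m × Pos m) × Pos m => c y.1 := hc.comp continuous_fst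
    have h3 : Continuous fun y : (Pos m × Pos m) × Pos m =>
        ((Real.exp (-(‖p - y.2‖ ^ 2 + ‖q - y.1.2‖ ^ 2)) : ℝ) : ℂ) := by fun_prop
    have h4 : Continuous fun y : (Pos m × Pos m) × Pos m =>
        Complex.exp (-Complex.I * ((inner ℝ y.1.1 y.2 : ℝ) : ℂ)) := by fun_prop
    exact h2.aestronglyMeasurable.mul
      ((h1.mul h3.aestronglyMeasurable).mul h4.aestronglyMeasurable)
  · obtain ⟨⟨t, b⟩, a⟩ := y
    simp only [Function.comp_apply, shuffle_apply, norm_mul, norm_tripleIntegrand]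
    have h1 : Real.exp (-‖q - b‖ ^ 2) ≤ 1 := Real.exp_le_one_iff.2 (neg_nonpos.2 (by positivity))
    calc _ = ‖c (t, b)‖ * ‖K (tau m (t, b))‖ * (Real.exp (-‖p - a‖ ^ 2)) *
          Real.exp (-‖q - b‖ ^ 2) := by ring
      _ ≤ _ := mul_le_of_le_one_right (by positivity) h1

theorem integral_triple_eq_iterated {F : Pos m × Pos m × Pos m → ℂ} (hF : Integrable F) :
    ∫ x, F x = ∫ z : Pos m × Pos m, ∫ a : Pos m, F (z.1, a, z.2) := by
  have h := (measurePreserving_shuffle m).integrable_comp_emb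
    (shuffle m).measurableEmbedding |>.2 hF
  rw [← (measurePreserving_shuffle m).integral_comp (shuffle m).measurableEmbedding]
  exact integral_prod _ h

theorem integrable_iterated_of_triple {F : Pos m × Pos m × Pos m → ℂ} (hF : Integrable F) :
    Integrable fun z : Pos m × Pos m => ∫ a : Pos m, F (z.1, a, z.2) := by
  have h := (measurePreserving_shuffle m).integrable_comp_emb
    (shuffle m).measurableEmbedding |>.2 hF
  exact Integrable.integral_prod_left h

variable {A : L2 m →L[ℂ] L2 m} {T : 𝓢'(Pos m × Pos m, ℂ)} {K : Pos m × Pos m → ℂ}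

theorem integrable_cutoff_mul_comp_tau (hK : LocallyIntegrable K volume)
    (χ : 𝓢(Pos m × Pos m, ℂ)) (hχ : HasCompactSupport χ) {ε : ℝ} (hε : ε ≠ 0) :
    Integrable fun z : Pos m × Pos m => χ (ε • z) * K (tau m z) := by
  have h : Integrable fun w : Pos m × Pos m => χ (ε • (tau m).symm w) * K w :=
    hK.integrable_smul_left_of_hasCompactSupport (by fun_prop)
      ((hχ.dilate hε).comp_homeomorph (tau m).symm.toHomeomorph)
  simpa using integrable_comp_tau.2 h

/-- The cut-off triple integral is `π^m T` applied to the cut-off test function. -/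
theorem integral_cutoff_tripleIntegrand (hT : IsRegularWith T K) (q p : Pos m)
    (χ : 𝓢(Pos m × Pos m, ℂ)) (hχ : HasCompactSupport χ) {ε : ℝ} (hε : ε ≠ 0) :
    ((1 / Real.pi ^ m : ℝ) : ℂ) * ∫ x : Pos m × Pos m × Pos m,
        χ (ε • x.1, ε • x.2.2) * tripleIntegrand K q p x.1 x.2.1 x.2.2 =
      T (cutoff (SchwartzMap.compCLMOfContinuousLinearEquiv ℂ (tau m).symm χ)
        (coherentTest q p) ε) := by
  have hint := integrable_mul_tripleIntegrand hT.1.aestronglyMeasurable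
    (c := fun z => χ (ε • z)) (by fun_prop)
    (integrable_cutoff_mul_comp_tau hT.1 χ hχ hε) q p
  have h1 : HasCompactSupport (SchwartzMap.compCLMOfContinuousLinearEquiv ℂ (tau m).symm χ) :=
    hχ.comp_homeomorph (tau m).symm.toHomeomorph
  rw [hT.2 _ (hasCompactSupport_cutoff h1 _ hε), ← integral_comp_tau]
  have h2 := integral_triple_eq_iterated hint
  simp only [Prod.smul_mk] at h2
  rw [h2, ← integral_const_mul]
  congr 1
  funext z
  rw [integral_const_mul, integral_tripleIntegrand_inner, cutoff_apply,
    SchwartzMap.compCLMOfContinuousLinearEquiv_apply, Function.comp_apply, map_smul,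
    ContinuousLinearEquiv.symm_apply_apply]
  have hp : ((Real.pi ^ m : ℝ) : ℂ) ≠ 0 := mod_cast (pow_pos Real.pi_pos m).ne'
  have e : (ε • z.1, ε • z.2) = ε • z := rfl
  rw [e]
  push_cast at hp ⊢
  field_simp

theorem tendsto_cutoff_tripleIntegral (hA : IsSchwartzKernel A T) (hT : IsRegularWith T K)
    (q p : Pos m) (χ : 𝓢(Pos m × Pos m, ℂ)) (hχ : HasCompactSupport χ) (h0 : χ 0 = 1) :
    Filter.Tendsto (fun ε : ℝ => ((1 / Real.pi ^ m : ℝ) : ℂ) *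
        ∫ x : Pos m × Pos m × Pos m,
          χ (ε • x.1, ε • x.2.2) * tripleIntegrand K q p x.1 x.2.1 x.2.2)
      (𝓝[>] 0) (𝓝 (expectedValue A q p)) := by
  have h1 := tendsto_cutoff (SchwartzMap.compCLMOfContinuousLinearEquiv ℂ (tau m).symm χ)
    (coherentTest q p) (by simpa using h0)
  rw [expectedValue_eq_apply_coherentTest hA]
  refine ((T.continuous.tendsto _).comp h1).congr' ?_
  filter_upwards [self_mem_nhdsWithin] with ε hε
  exact (integral_cutoff_tripleIntegrand hT q p χ hχ (ne_of_gt hε)).symm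

/-- If `K` times the test function is integrable, dominated convergence removes the cut-off. -/
theorem apply_coherentTest_eq_integral (hT : IsRegularWith T K) (q p : Pos m)
    (h : Integrable fun z => K z * coherentTest q p z) :
    T (coherentTest q p) = ∫ z, K z * coherentTest q p z := by
  obtain ⟨χ, hχ, h0⟩ := exists_cutoff (E := Pos m × Pos m)
  have h1 := (T.continuous.tendsto _).comp (tendsto_cutoff χ (coherentTest q p) h0)
  refine tendsto_nhds_unique h1 ?_
  have h2 : Filter.Tendsto (fun ε : ℝ => ∫ z, χ (ε • z) * (K z * coherentTest q p z))
      (𝓝[>] 0) (𝓝 (∫ z, K z * coherentTest q p z)) := by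
    refine tendsto_integral_filter_of_dominated_convergence
      (fun z => SchwartzMap.seminorm ℝ 0 0 χ * ‖K z * coherentTest q p z‖) ?_ ?_
      (h.norm.const_mul _) ?_
    · refine Filter.Eventually.of_forall fun ε => ?_
      have : Continuous fun z : Pos m × Pos m => χ (ε • z) := by fun_prop
      exact this.aestronglyMeasurable.mul h.aestronglyMeasurable
    · refine Filter.Eventually.of_forall fun ε => Filter.Eventually.of_forall fun z => ?_
      rw [norm_mul]
      gcongr
      exact norm_le_seminorm ℝ χ _
    · refine Filter.Eventually.of_forall fun z => ?_
      have hc : Continuous fun ε : ℝ => χ (ε • z) * (K z * coherentTest q p z) := by fun_prop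
      have := hc.tendsto 0
      rw [zero_smul, h0, one_mul] at this
      exact this.mono_left nhdsWithin_le_nhds
  refine h2.congr' ?_
  filter_upwards [self_mem_nhdsWithin] with ε hε
  refine Eq.trans ?_ (hT.2 _ (hasCompactSupport_cutoff hχ _ (ne_of_gt hε))).symm
  congr 1
  funext z
  rw [cutoff_apply]
  ring

theorem integrable_inner_iff (K : Pos m × Pos m → ℂ) (q p : Pos m) :
    Integrable (fun z : Pos m × Pos m => ∫ a : Pos m, tripleIntegrand K q p z.1 a z.2) ↔
      Integrable fun z => K z * coherentTest q p z := by
  have hp : ((Real.pi ^ m : ℝ) : ℂ) ≠ 0 := mod_cast (pow_pos Real.pi_pos m).ne'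
  simp only [integral_tripleIntegrand_inner]
  rw [integrable_const_mul_iff hp.isUnit,
    integrable_comp_tau (f := fun z => K z * coherentTest q p z)]

theorem expectedValue_eq_iterated (hA : IsSchwartzKernel A T) (hT : IsRegularWith T K)
    (q p : Pos m)
    (h : Integrable fun z : Pos m × Pos m => ∫ a : Pos m, tripleIntegrand K q p z.1 a z.2) :
    expectedValue A q p = ((1 / Real.pi ^ m : ℝ) : ℂ) *
      ∫ z : Pos m × Pos m, ∫ a : Pos m, tripleIntegrand K q p z.1 a z.2 := by
  rw [expectedValue_eq_apply_coherentTest hA,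
    apply_coherentTest_eq_integral hT q p ((integrable_inner_iff K q p).1 h)]
  simp only [integral_tripleIntegrand_inner]
  rw [integral_const_mul, integral_comp_tau (fun z => K z * coherentTest q p z), ← mul_assoc,
    ← Complex.ofReal_mul, one_div_mul_cancel (pow_pos Real.pi_pos m).ne', Complex.ofReal_one,
    one_mul]

end Regular

/-! ### Existence of the Schwartz kernel -/

section Kernel

variable {m : ℕ}

instance isAddHaarMeasure_volume_prod :
    (volume : Measure (Pos m × Pos m)).IsAddHaarMeasure :=
  inferInstanceAs ((volume : Measure (Pos m)).prod volume).IsAddHaarMeasure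

/-- The weight `(1 + ‖x‖²)^{m+1}`, whose reciprocal is square integrable. -/
noncomputable def weight (x : Pos m) : ℝ := (1 + ‖x‖ ^ 2) ^ (m + 1)

theorem weight_pos (x : Pos m) : 0 < weight x := by unfold weight; positivity

theorem continuous_weight : Continuous (weight (m := m)) := by unfold weight; fun_prop

theorem continuous_weight_inv : Continuous fun x : Pos m => (weight x)⁻¹ :=
  continuous_weight.inv₀ fun x => (weight_pos x).ne'

theorem hasTemperateGrowth_weight : (fun x : Pos m => (weight x : ℂ)).HasTemperateGrowth := by
  have h1 : (fun x : Pos m => 1 + ‖x‖ ^ 2).HasTemperateGrowth :=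
    (Function.HasTemperateGrowth.const 1).add (Function.hasTemperateGrowth_norm_sq (H := Pos m))
  have h2 : ∀ n : ℕ, (fun x : Pos m => (1 + ‖x‖ ^ 2) ^ n).HasTemperateGrowth := by
    intro n
    induction n with
    | zero => simp
    | succ n ih =>
      simp only [pow_succ _ n]
      exact ih.mul h1
  exact (Complex.ofRealCLM.hasTemperateGrowth).comp (h2 (m + 1))

theorem integrable_weight_inv_sq : Integrable fun x : Pos m => ((weight x)⁻¹) ^ 2 := by
  have h := integrable_rpow_neg_one_add_norm_sq (E := Pos m) (μ := volume)
    -- squaring the weight doubles its exponent `m + 1`, and `(1 + ‖x‖²)^(-r/2)` needs `r > m`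
    (r := 4 * (m + 1 : ℕ)) (by
      rw [finrank_euclideanSpace, Fintype.card_fin]; push_cast; linarith)
  refine h.congr (Filter.Eventually.of_forall fun x => ?_)
  have e : -(4 * ((m + 1 : ℕ) : ℝ)) / 2 = -(((m + 1) * 2 : ℕ) : ℝ) := by push_cast; ring
  simp only
  rw [e, Real.rpow_neg (by positivity), Real.rpow_natCast, weight, inv_pow, ← pow_mul]

/-- The plane wave `exp (2πi ⟪η, x⟫)`, damped by the weight. -/
noncomputable def dampedWave (η x : Pos m) : ℂ :=
  (((weight x)⁻¹ : ℝ) : ℂ) * Complex.exp (((2 * Real.pi * inner ℝ η x : ℝ) : ℂ) * Complex.I)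

theorem continuous_dampedWave (η : Pos m) : Continuous (dampedWave η) := by
  unfold dampedWave
  exact (Complex.continuous_ofReal.comp continuous_weight_inv).mul (by fun_prop)

theorem norm_dampedWave (η x : Pos m) : ‖dampedWave η x‖ = (weight x)⁻¹ := by
  rw [dampedWave, norm_mul, Complex.norm_exp_ofReal_mul_I, mul_one, Complex.norm_real,
    Real.norm_of_nonneg (inv_pos.2 (weight_pos x)).le]

theorem memLp_dampedWave (η : Pos m) : MemLp (dampedWave η) 2 volume := by
  rw [memLp_two_iff_integrable_sq_norm (continuous_dampedWave η).aestronglyMeasurable]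
  simpa only [norm_dampedWave] using integrable_weight_inv_sq (m := m)

/-- The damped plane wave as a vector of `L²`. -/
noncomputable def wave (η : Pos m) : L2 m := (memLp_dampedWave η).toLp (dampedWave η)

theorem inner_wave_wave (ξ η : Pos m) : inner ℂ (wave ξ) (wave η) =
    ∫ x : Pos m, ((((weight x)⁻¹) ^ 2 : ℝ) : ℂ) *
      Complex.exp (((2 * Real.pi * inner ℝ (η - ξ) x : ℝ) : ℂ) * Complex.I) := by
  rw [L2.inner_def]
  refine integral_congr_ae ?_
  filter_upwards [(memLp_dampedWave ξ).coeFn_toLp, (memLp_dampedWave η).coeFn_toLp] with x h1 h2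
  rw [wave, wave, h1, h2, RCLike.inner_apply, dampedWave, dampedWave]
  simp only [map_mul, Complex.conj_ofReal, ← Complex.exp_conj, Complex.conj_I]
  rw [inner_sub_left]
  have e : (((2 * Real.pi * (inner ℝ η x - inner ℝ ξ x) : ℝ) : ℂ) * Complex.I) =
      ((2 * Real.pi * inner ℝ η x : ℝ) : ℂ) * Complex.I +
        ((2 * Real.pi * inner ℝ ξ x : ℝ) : ℂ) * -Complex.I := by push_cast; ring
  rw [e, Complex.exp_add]
  push_cast
  ring

theorem continuous_inner_wave_wave :
    Continuous fun z : Pos m × Pos m => (inner ℂ (wave z.1) (wave z.2) : ℂ) := by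
  simp only [inner_wave_wave]
  refine continuous_of_dominated (bound := fun x => ((weight x)⁻¹) ^ 2) (fun z => ?_) (fun z => ?_)
    integrable_weight_inv_sq ?_
  · refine Continuous.aestronglyMeasurable ?_
    exact (Complex.continuous_ofReal.comp (continuous_weight_inv.pow 2)).mul (by fun_prop)
  · refine Filter.Eventually.of_forall fun x => ?_
    rw [norm_mul, Complex.norm_exp_ofReal_mul_I, mul_one, Complex.norm_real,
      Real.norm_of_nonneg (by positivity)]
  · exact Filter.Eventually.of_forall fun x => by fun_prop

theorem norm_wave (η : Pos m) : ‖wave η‖ = ‖wave (0 : Pos m)‖ := by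
  have h : ∀ ζ : Pos m, ‖wave ζ‖ ^ 2 = RCLike.re (∫ x : Pos m, ((((weight x)⁻¹) ^ 2 : ℝ) : ℂ)) := by
    intro ζ
    rw [← inner_self_eq_norm_sq (𝕜 := ℂ), inner_wave_wave]
    simp
  have h2 := (h η).trans (h 0).symm
  exact (pow_left_inj₀ (norm_nonneg _) (norm_nonneg _) two_ne_zero).1 h2

/-- A map into a Hilbert space with constant norm is continuous if it is weakly continuous along
its own values. -/
theorem continuous_of_inner_of_norm {X H : Type*} [TopologicalSpace X] [NormedAddCommGroup H]
    [InnerProductSpace ℂ H] {f : X → H} {r : ℝ} (hr : ∀ x, ‖f x‖ = r)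
    (hf : ∀ y, Continuous fun x => (inner ℂ (f x) (f y) : ℂ)) : Continuous f := by
  refine continuous_iff_continuousAt.2 fun y => ?_
  rw [ContinuousAt, tendsto_iff_norm_sub_tendsto_zero]
  have h2 : ∀ x, ‖f x - f y‖ ^ 2 = 2 * (r ^ 2 - (inner ℂ (f x) (f y) : ℂ).re) := by
    intro x
    rw [norm_sub_sq (𝕜 := ℂ), hr, hr, RCLike.re_to_complex]
    ring
  have h0 : (inner ℂ (f y) (f y) : ℂ).re = r ^ 2 := by
    rw [← hr y]
    exact inner_self_eq_norm_sq (𝕜 := ℂ) (f y)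
  have h3 : Filter.Tendsto (fun x => ‖f x - f y‖ ^ 2) (𝓝 y) (𝓝 0) := by
    have h4 := (Complex.continuous_re.comp (hf y)).tendsto y
    have h5 := (h4.const_sub (r ^ 2)).const_mul 2
    simp only [Function.comp_apply, h0, sub_self, mul_zero] at h5
    exact h5.congr fun x => (h2 x).symm
  have h6 := (Real.continuous_sqrt.tendsto 0).comp h3
  rw [Real.sqrt_zero] at h6
  exact h6.congr fun x => Real.sqrt_sq (norm_nonneg _)

theorem continuous_wave : Continuous (wave (m := m)) := by
  refine continuous_of_inner_of_norm norm_wave fun η => ?_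
  have h := (continuous_inner_wave_wave (m := m)).comp
    (continuous_id.prodMk (continuous_const (y := η)))
  exact h

/-- Multiplication of a Schwartz function by the weight. -/
noncomputable def weighted (φ : 𝓢(Pos m, ℂ)) : 𝓢(Pos m, ℂ) :=
  smulLeftCLM ℂ (fun x : Pos m => (weight x : ℂ)) φ

theorem weighted_apply (φ : 𝓢(Pos m, ℂ)) (x : Pos m) : weighted φ x = weight x * φ x :=
  smulLeftCLM_apply_apply hasTemperateGrowth_weight φ x

/-- Fourier inversion for the weighted function, written with damped waves. -/
theorem integral_fourier_weighted_mul_dampedWave (φ : 𝓢(Pos m, ℂ)) (x : Pos m) :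
    ∫ η, 𝓕 (weighted φ) η * dampedWave η x = φ x := by
  have h1 : 𝓕⁻ (𝓕 (weighted φ)) x = weighted φ x := by rw [FourierTransform.fourierInv_fourier_eq]
  rw [SchwartzMap.fourierInv_coe, Real.fourierInv_eq', weighted_apply] at h1
  have hw : (weight x : ℂ) ≠ 0 := mod_cast (weight_pos x).ne'
  calc _ = ∫ η, (((weight x)⁻¹ : ℝ) : ℂ) *
        (Complex.exp (((2 * Real.pi * inner ℝ η x : ℝ) : ℂ) * Complex.I) • 𝓕 (weighted φ) η) := by
        congr 1; funext η; rw [dampedWave, smul_eq_mul]; ring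
    _ = _ := by
        rw [integral_const_mul, h1]
        push_cast
        rw [inv_mul_cancel_left₀ hw]

/-- Weak form of `∫ 𝓕(weighted φ)(η) wave η dη = φ` in `L²`. -/
theorem integral_fourier_weighted_mul_inner_wave (h : L2 m) (φ : 𝓢(Pos m, ℂ)) :
    ∫ η, 𝓕 (weighted φ) η * inner ℂ h (wave η) =
      inner ℂ h (φ.toLp 2 (volume : Measure (Pos m))) := by
  have e1 : ∀ η, 𝓕 (weighted φ) η * inner ℂ h (wave η) =
      ∫ x, 𝓕 (weighted φ) η * (starRingEnd ℂ (h x) * dampedWave η x) := by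
    intro η
    rw [integral_const_mul, L2.inner_def]
    congr 1
    refine integral_congr_ae ?_
    filter_upwards [(memLp_dampedWave η).coeFn_toLp] with x h1
    rw [wave, h1, RCLike.inner_apply, mul_comm]
  have hm : AEStronglyMeasurable (h : Pos m → ℂ) volume := Lp.aestronglyMeasurable h
  have hint : Integrable fun x : Pos m => ‖h x‖ * (weight x)⁻¹ := by
    have h1 := (Lp.memLp h).norm
    have h2 := (memLp_dampedWave (0 : Pos m)).norm
    simp only [norm_dampedWave] at h2
    exact h1.integrable_mul h2
  have hprod : Integrable (Function.uncurry fun η x : Pos m =>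
      𝓕 (weighted φ) η * (starRingEnd ℂ (h x) * dampedWave η x))
      ((volume : Measure (Pos m)).prod volume) := by
    refine ((𝓕 (weighted φ)).integrable.norm.mul_prod hint).mono' ?_ ?_
    · have c1 : Continuous fun z : Pos m × Pos m => 𝓕 (weighted φ) z.1 :=
        (𝓕 (weighted φ)).continuous.comp continuous_fst
      have c2 : Continuous fun z : Pos m × Pos m => dampedWave z.1 z.2 := by
        unfold dampedWave
        exact (Complex.continuous_ofReal.comp (continuous_weight_inv.comp continuous_snd)).mul
          (by fun_prop)
      have c3 : AEStronglyMeasurable (fun z : Pos m × Pos m => starRingEnd ℂ (h z.2))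
          (volume.prod volume) :=
        Complex.continuous_conj.comp_aestronglyMeasurable hm.comp_snd
      exact c1.aestronglyMeasurable.mul (c3.mul c2.aestronglyMeasurable)
    · refine Filter.Eventually.of_forall fun z => le_of_eq ?_
      simp only [Function.uncurry, norm_mul, norm_dampedWave, RCLike.norm_conj]
  simp only [e1]
  rw [integral_integral_swap hprod, L2.inner_def]
  refine integral_congr_ae ?_
  filter_upwards [φ.coeFn_toLp 2 volume] with x hx
  rw [hx, RCLike.inner_apply]
  calc _ = ∫ η, starRingEnd ℂ (h x) * (𝓕 (weighted φ) η * dampedWave η x) := by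
        congr 1; funext η; ring
    _ = _ := by
        rw [integral_const_mul, integral_fourier_weighted_mul_dampedWave, mul_comm]

theorem fourier_weighted_conjSchwartz (φ : 𝓢(Pos m, ℂ)) (ξ : Pos m) :
    𝓕 (weighted (conjSchwartz φ)) ξ = starRingEnd ℂ (𝓕 (weighted φ) (-ξ)) := by
  rw [SchwartzMap.fourier_coe, SchwartzMap.fourier_coe, Real.fourier_eq', Real.fourier_eq',
    ← integral_conj]
  congr 1
  funext v
  rw [weighted_apply, weighted_apply, conjSchwartz_apply]
  simp only [smul_eq_mul, map_mul, Complex.conj_ofReal, ← Complex.exp_conj, Complex.conj_I]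
  rw [inner_neg_right]
  congr 2
  push_cast
  ring

/-- The weighted Fourier transform in both variables, as a continuous operator on the Schwartz
space: it acts on tensor products factor by factor. -/
theorem exists_weightedFourier (m : ℕ) : ∃ D : 𝓢(Pos m × Pos m, ℂ) →L[ℂ] 𝓢(Pos m × Pos m, ℂ),
    ∀ φ ψ, D (tensor φ ψ) = tensor (𝓕 (weighted φ)) (𝓕 (weighted ψ)) := by
  obtain ⟨P, hP⟩ := PartialFourier.exists_pfunCLM (V := Pos m)
  let S : 𝓢(Pos m × Pos m, ℂ) →L[ℂ] 𝓢(Pos m × Pos m, ℂ) :=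
    SchwartzMap.compCLMOfContinuousLinearEquiv ℂ (ContinuousLinearEquiv.prodComm ℝ (Pos m) (Pos m))
  let W : 𝓢(Pos m × Pos m, ℂ) →L[ℂ] 𝓢(Pos m × Pos m, ℂ) :=
    smulLeftCLM ℂ (fun z : Pos m × Pos m => (weight z.1 : ℂ) * (weight z.2 : ℂ))
  have hS : ∀ φ ψ, S (tensor φ ψ) = tensor ψ φ := by
    intro φ ψ
    ext z
    exact mul_comm _ _
  have hW : ∀ φ ψ, W (tensor φ ψ) = tensor (weighted φ) (weighted ψ) := by
    intro φ ψ
    have ht : (fun z : Pos m × Pos m => (weight z.1 : ℂ) * (weight z.2 : ℂ)).HasTemperateGrowth :=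
      (hasTemperateGrowth_weight.comp
        (ContinuousLinearMap.fst ℝ (Pos m) (Pos m)).hasTemperateGrowth).mul
      (hasTemperateGrowth_weight.comp
        (ContinuousLinearMap.snd ℝ (Pos m) (Pos m)).hasTemperateGrowth)
    ext z
    have e1 : W (tensor φ ψ) z = (weight z.1 : ℂ) * (weight z.2 : ℂ) * (φ z.1 * ψ z.2) :=
      smulLeftCLM_apply_apply ht _ z
    have e2 : tensor (weighted φ) (weighted ψ) z = weighted φ z.1 * weighted ψ z.2 := rfl
    rw [e1, e2, weighted_apply, weighted_apply]
    ring
  have hPt : ∀ φ ψ, P (tensor φ ψ) = tensor (𝓕 φ) ψ := by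
    intro φ ψ
    ext z
    have e2 : tensor (𝓕 φ) ψ z = 𝓕 φ z.1 * ψ z.2 := rfl
    rw [hP, e2, SchwartzMap.fourier_coe, Real.fourier_eq, PartialFourier.pfun,
      ← integral_mul_const]
    congr 1
    funext a
    have e3 : tensor φ ψ (a, z.2) = φ a * ψ z.2 := rfl
    rw [PartialFourier.integrand, e3, smul_eq_mul, Circle.smul_def, smul_eq_mul, mul_assoc]
  -- `P` transforms the first variable only, so the variables are exchanged before each use
  refine ⟨P ∘L S ∘L P ∘L S ∘L W, fun φ ψ => ?_⟩
  simp only [ContinuousLinearMap.comp_apply, hW, hS, hPt]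

/-- The matrix elements of `A` between damped waves. The sign in `wave (-ξ)` compensates the complex
conjugation of the first argument: the kernel is paired with `conj φ`, and
`𝓕 (w conj φ) ξ = conj (𝓕 (w φ) (-ξ))`. -/
noncomputable def waveSymbol (A : L2 m →L[ℂ] L2 m) (z : Pos m × Pos m) : ℂ :=
  inner ℂ (wave (-z.1)) (A (wave z.2))

theorem continuous_waveSymbol (A : L2 m →L[ℂ] L2 m) : Continuous (waveSymbol A) :=
  (continuous_wave.comp (continuous_neg.comp continuous_fst)).inner
    (A.continuous.comp (continuous_wave.comp continuous_snd))

theorem norm_waveSymbol_le (A : L2 m →L[ℂ] L2 m) (z : Pos m × Pos m) :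
    ‖waveSymbol A z‖ ≤ ‖wave (0 : Pos m)‖ * (‖A‖ * ‖wave (0 : Pos m)‖) := by
  refine (norm_inner_le_norm _ _).trans ?_
  rw [norm_wave]
  gcongr
  refine (A.le_opNorm _).trans ?_
  rw [norm_wave]

theorem integral_tensor_fourier_mul_waveSymbol (A : L2 m →L[ℂ] L2 m) (φ ψ : 𝓢(Pos m, ℂ)) :
    ∫ z, tensor (𝓕 (weighted (conjSchwartz φ))) (𝓕 (weighted ψ)) z * waveSymbol A z =
      inner ℂ (φ.toLp 2 (volume : Measure (Pos m))) (A (ψ.toLp 2 (volume : Measure (Pos m)))) := by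
  have hint : Integrable (fun z => tensor (𝓕 (weighted (conjSchwartz φ))) (𝓕 (weighted ψ)) z *
      waveSymbol A z) (volume : Measure (Pos m × Pos m)) :=
    (SchwartzMap.integrable _).mul_bdd (continuous_waveSymbol A).aestronglyMeasurable
      (Filter.Eventually.of_forall (norm_waveSymbol_le A))
  have e1 : ∀ ξ η : Pos m, tensor (𝓕 (weighted (conjSchwartz φ))) (𝓕 (weighted ψ)) (ξ, η) *
      waveSymbol A (ξ, η) = 𝓕 (weighted (conjSchwartz φ)) ξ * (𝓕 (weighted ψ) η *
        inner ℂ (ContinuousLinearMap.adjoint A (wave (-ξ))) (wave η)) := by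
    intro ξ η
    rw [ContinuousLinearMap.adjoint_inner_left]
    exact mul_assoc _ _ _
  have e2 : ∀ ξ : Pos m, ∫ η, tensor (𝓕 (weighted (conjSchwartz φ))) (𝓕 (weighted ψ)) (ξ, η) *
      waveSymbol A (ξ, η) = starRingEnd ℂ (𝓕 (weighted φ) (-ξ) *
        inner ℂ (A (ψ.toLp 2 (volume : Measure (Pos m)))) (wave (-ξ))) := by
    intro ξ
    simp only [e1]
    rw [integral_const_mul, integral_fourier_weighted_mul_inner_wave,
      ContinuousLinearMap.adjoint_inner_left, fourier_weighted_conjSchwartz, map_mul,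
      inner_conj_symm]
  rw [Measure.volume_eq_prod] at hint ⊢
  rw [integral_prod _ hint]
  simp only [e2]
  rw [integral_conj, integral_neg_eq_self (fun ξ => 𝓕 (weighted φ) ξ *
    inner ℂ (A (ψ.toLp 2 (volume : Measure (Pos m)))) (wave ξ)) volume,
    integral_fourier_weighted_mul_inner_wave, inner_conj_symm]

theorem exists_isSchwartzKernel (A : L2 m →L[ℂ] L2 m) :
    ∃ T : 𝓢'(Pos m × Pos m, ℂ), IsSchwartzKernel A T := by
  obtain ⟨D, hD⟩ := exists_weightedFourier m
  have hk : MemLp (waveSymbol A) ⊤ (volume : Measure (Pos m × Pos m)) :=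
    memLp_top_of_bound (continuous_waveSymbol A).aestronglyMeasurable _
      (Filter.Eventually.of_forall (norm_waveSymbol_le A))
  refine ⟨PointwiseConvergenceCLM.precomp ℂ D
    (Lp.toTemperedDistribution (hk.toLp (waveSymbol A))), fun φ ψ => ?_⟩
  have e : PointwiseConvergenceCLM.precomp ℂ D
      (Lp.toTemperedDistribution (hk.toLp (waveSymbol A))) (tensor (conjSchwartz φ) ψ) =
      Lp.toTemperedDistribution (hk.toLp (waveSymbol A)) (D (tensor (conjSchwartz φ) ψ)) := rfl
  rw [e, hD, Lp.toTemperedDistribution_apply, ← integral_tensor_fourier_mul_waveSymbol]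
  refine integral_congr_ae ?_
  filter_upwards [hk.coeFn_toLp] with z hz
  rw [hz, smul_eq_mul]

end Kernel

end PhaseSpace

theorem theorem8 (m : ℕ) (A : L2 m →L[ℂ] L2 m) :
    -- the Schwartz kernel of `A` exists
    (∃ T : 𝓢'(Pos m × Pos m, ℂ), IsSchwartzKernel A T) ∧
    ∀ T : 𝓢'(Pos m × Pos m, ℂ), IsSchwartzKernel A T →
      (∀ q p : Pos m, expectedValue A q p =
        (((2 * Real.pi) ^ (3 * (m : ℝ) / 2) : ℝ) : ℂ) *
          convolveDistribution (omega m) (partialFourierDistribution (compTau T)) (p, q)) ∧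
      ∀ K : Pos m × Pos m → ℂ, IsRegularWith T K → ∀ q p : Pos m,
        -- the triple integral, regularized by a cut-off in `(t, b)`
        (∀ χ : 𝓢(Pos m × Pos m, ℂ), HasCompactSupport χ → χ 0 = 1 →
          (∀ ε : ℝ, 0 < ε → Integrable (fun x : Pos m × Pos m × Pos m =>
            χ (ε • x.1, ε • x.2.2) * tripleIntegrand K q p x.1 x.2.1 x.2.2) volume) ∧
          Filter.Tendsto (fun ε : ℝ => ((1 / Real.pi ^ m : ℝ) : ℂ) *
              ∫ x : Pos m × Pos m × Pos m,
                χ (ε • x.1, ε • x.2.2) * tripleIntegrand K q p x.1 x.2.1 x.2.2)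
            (𝓝[>] 0) (𝓝 (expectedValue A q p))) ∧
        -- the triple integral, with the integration over `a` performed first
        (Integrable (fun z : Pos m × Pos m => ∫ a : Pos m, tripleIntegrand K q p z.1 a z.2) volume →
          expectedValue A q p = ((1 / Real.pi ^ m : ℝ) : ℂ) *
            ∫ z : Pos m × Pos m, ∫ a : Pos m, tripleIntegrand K q p z.1 a z.2) ∧
        ((∀ f : 𝓢(Pos m × Pos m, ℂ), Integrable (fun z => K z * f z) volume) →
          Integrable (fun z : Pos m × Pos m => ∫ a : Pos m, tripleIntegrand K q p z.1 a z.2)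
            volume) ∧
        -- the absolutely convergent triple integral
        (Integrable (fun x : Pos m × Pos m × Pos m => tripleIntegrand K q p x.1 x.2.1 x.2.2) volume →
          expectedValue A q p = ((1 / Real.pi ^ m : ℝ) : ℂ) *
            ∫ x : Pos m × Pos m × Pos m, tripleIntegrand K q p x.1 x.2.1 x.2.2) := by
  refine ⟨exists_isSchwartzKernel A, fun T hA => ⟨expectedValue_eq_convolution hA,
    fun K hT q p => ⟨fun χ hχ h0 => ⟨fun ε hε => ?_,
      tendsto_cutoff_tripleIntegral hA hT q p χ hχ h0⟩,
      expectedValue_eq_iterated hA hT q p,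
      fun h => (integrable_inner_iff K q p).2 (h (coherentTest q p)), fun h => ?_⟩⟩⟩
  · exact integrable_mul_tripleIntegrand hT.1.aestronglyMeasurable
      (c := fun z => χ (ε • z)) (by fun_prop)
      (integrable_cutoff_mul_comp_tau hT.1 χ hχ hε.ne') q p
  · rw [integral_triple_eq_iterated h]
    exact expectedValue_eq_iterated hA hT q p (integrable_iterated_of_triple h)
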